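/- **Setting.** Let $\hat{\mathbb C}=\mathbb C\cup\{\infty\}$, $\mathbb H=\{z:\operatorname{Im}z>0\}$, $\mathbb R_+=[0,\infty)$, and let $\sqrt{\cdot}$ be the branch of the square root with values in $\mathbb H\cup\mathbb R_+$. Let $\gamma:[-\infty,\infty]\to\hat{\mathbb C}$ be a Jordan curve, i.e. $\gamma$ is continuous, $\gamma(-\infty)=\gamma(\infty)$ and $\gamma$ is injective on $[-\infty,\infty)$. For each $t\in\mathbb R$ let $H_t:\hat{\mathbb C}\smallsetminus\gamma[-\infty,t]\to\mathbb C\smallsetminus\mathbb R_+$ be a conformal bijection with $H_t(\gamma(t))=0$ and $H_t(\gamma(\infty))=\infty$ in the sense of boundary limits, normalized so that $h_t:=H_t\circ H_0^{-1}$ satisfies $h_t(z)=z+o(z)$ as $z\to\infty$. Put $f_t(z)=\sqrt{h_t(z^2)}$. Assume that $\gamma$ is parametrized by capacity, that is, for every $t\in\mathbb R$, $$f_t(z)=z-\lambda_t+\frac{2t}{z}+O\Big(\frac1{z^2}\Big)\qquad (z\to\infty,\ z\in\mathbb H);$$ this defines the driving function $\lambda:\mathbb R\to\mathbb R$ of $\gamma$.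 The Loewner energy is $I^L(\gamma)=\frac12\int_{-\infty}^{\infty}\dot\lambda_t^2\,\mathrm dt$, understood as $+\infty$ if $\lambda$ is not locally absolutely continuous. **Lemma.** Suppose $I^L(\gamma)<\infty$, and let $D=\{z\in\mathbb H: z^2\in H_0(\hat{\mathbb C}\smallsetminus\gamma)\}$, where $\gamma$ also denotes the image of the curve. Then, both as $t\to+\infty$ and as $t\to-\infty$, $$\frac{f_t(z)^2}{4t}\to 1\qquad\text{and}\qquad |f_t'(z)|=|t|^{-1/2+o(1)},$$ locally uniformly for $z\in D$. The second assertion means that for $|t|>1$ and $z\in D$ the map $f_t$ is complex differentiable at $z$ with $|f_t'(z)|=|t|^{-1/2+e_t(z)}$, where $e_t\to0$ locally uniformly on $D$ as $t\to\pm\infty$. -/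

import Mathlib

open Set Filter Topology MeasureTheory Asymptotics

noncomputable section

namespace LoopLoewner

/-- The Riemann sphere `ℂ ∪ {∞}`. -/
abbrev Sphere : Type := OnePoint ℂ

/-- The chart `w ↦ 1 / w` of the Riemann sphere centred at `∞`. -/
def invChart (w : ℂ) : Sphere := if w = 0 then OnePoint.infty else ((w⁻¹ : ℂ) : OnePoint ℂ)

/-- `F` is a holomorphic complex-valued function on the open subset `U` of the Riemann sphere:
it is holomorphic in the affine chart, and, if `∞ ∈ U`, in the chart at `∞`. -/
def HolomorphicOnSphere (F : Sphere → ℂ) (U : Set Sphere) : Prop :=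
  DifferentiableOn ℂ (fun z : ℂ => F (z : OnePoint ℂ)) {z : ℂ | (z : OnePoint ℂ) ∈ U} ∧
    (OnePoint.infty ∈ U → DifferentiableAt ℂ (fun w : ℂ => F (invChart w)) 0)

/-- The upper half-plane as a set of complex numbers. -/
def upperHalf : Set ℂ := {z | 0 < z.im}

/-- The slit plane `ℂ ∖ ℝ₊`, where `ℝ₊ = [0, ∞)`. -/
def slitPlus : Set ℂ := {z | ¬ (z.im = 0 ∧ 0 ≤ z.re)}

open Classical in
/-- The branch of the square root with values in `ℍ ∪ ℝ₊`.  Off `ℝ₊` it is `i √(-z)`, where the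
principal root of `-z` is holomorphic. -/
def sqrtUp (z : ℂ) : ℂ :=
  if z ∈ slitPlus then Complex.I * (-z) ^ (1 / 2 : ℂ) else (Real.sqrt z.re : ℂ)

/-- A Jordan curve in the Riemann sphere, parametrized by `[-∞, ∞]`, with root
`γ (-∞) = γ (∞)`. -/
structure IsJordanCurve (γ : EReal → Sphere) : Prop where
  continuous : Continuous γ
  closed : γ ⊥ = γ ⊤
  injOn : InjOn γ (Iio ⊤)

/-- The complement of `γ[-∞, t]` in the Riemann sphere. -/
def slitDomain (γ : EReal → Sphere) (t : ℝ) : Set Sphere := (γ '' Iic (t : EReal))ᶜ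

/-- `H_t ∘ H_0⁻¹`, where `H_0⁻¹` takes values in the complement of `γ[-∞, 0]`. -/
def hChain (γ : EReal → Sphere) (H : ℝ → Sphere → ℂ) (t : ℝ) (z : ℂ) : ℂ :=
  H t (Function.invFunOn (H 0) (slitDomain γ 0) z)

/-- `f_t (z) = √(h_t (z²))`. -/
def fChain (γ : EReal → Sphere) (H : ℝ → Sphere → ℂ) (t : ℝ) (z : ℂ) : ℂ :=
  sqrtUp (hChain γ H t (z ^ 2))

/-- `H_t` are conformal maps of the complement of `γ[-∞, t]` onto `ℂ ∖ ℝ₊`, sending the tip `γ t`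
to `0` and the root to `∞` (as boundary limits), and normalized for `t ≠ 0` by
`H_t ∘ H_0⁻¹ (z) = z + o(z)` as `z → ∞`. -/
structure IsUniformizingFamily (γ : EReal → Sphere) (H : ℝ → Sphere → ℂ) : Prop where
  holomorphic : ∀ t : ℝ, HolomorphicOnSphere (H t) (slitDomain γ t)
  bijOn : ∀ t : ℝ, BijOn (H t) (slitDomain γ t) slitPlus
  tip : ∀ t : ℝ, Tendsto (H t) (𝓝[slitDomain γ t] (γ t)) (𝓝 0)
  root : ∀ t : ℝ, Tendsto (H t) (𝓝[slitDomain γ t] (γ ⊤)) (cocompact ℂ)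
  normalized : ∀ t : ℝ, (fun z : ℂ => hChain γ H t z - z)
    =o[cocompact ℂ ⊓ 𝓟 slitPlus] (fun z : ℂ => z)

/-- `f (z) = z - l + 2 a / z + O(1 / z²)` as `z → ∞` in the upper half-plane. -/
def HasExpansion (f : ℂ → ℂ) (l a : ℝ) : Prop :=
  (fun z : ℂ => f z - (z - (l : ℂ) + 2 * (a : ℂ) / z))
    =O[cocompact ℂ ⊓ 𝓟 upperHalf] (fun z : ℂ => 1 / z ^ 2)

/-- `lam` is the driving function of the chain `f_t`, and the curve is parametrized by capacity,
i.e. `a_t = t` for all `t`. -/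
def IsDrivingFunction (γ : EReal → Sphere) (H : ℝ → Sphere → ℂ) (lam : ℝ → ℝ) : Prop :=
  ∀ t : ℝ, HasExpansion (fChain γ H t) (lam t) t

open Classical in
/-- The Dirichlet energy `(1/2) ∫ (dλ/dt)² dt` over `ℝ`, with value `∞` if `lam` is not locally
absolutely continuous.  For the driving function of a curve this is its Loewner energy. -/
def loewnerEnergy (lam : ℝ → ℝ) : ENNReal :=
  if ∀ a b : ℝ, AbsolutelyContinuousOnInterval lam a b then
    (1 / 2) * ∫⁻ t : ℝ, ENNReal.ofReal ((deriv lam t) ^ 2)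
  else ⊤

/-- The points `z` of the upper half-plane with `z² ∈ H_0 (Ĉ ∖ γ)`. -/
def commonDomain (γ : EReal → Sphere) (H : ℝ → Sphere → ℂ) : Set ℂ :=
  {z | z ∈ upperHalf ∧ z ^ 2 ∈ H 0 '' (range γ)ᶜ}

end LoopLoewner

end

namespace LoopLoewner

/-! ### Inverses of injective holomorphic functions -/

section Inverse

variable {V : Set ℂ} {F G : ℂ → ℂ} {u : ℂ}

/-! Send the root of the loop to infinity by a Möbius map. The loop becomes a simple curve `c` in
the plane, and the square root `F t` of the uniformizing map carries the complement of `c (-∞, t]`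
onto the upper half-plane (`exists_isSlitChain`). For s < t the map F_s ∘ F_t⁻¹ expands as z + (λ_t
- λ_s) - 2(t - s)/z + O(1/z²) at infinity and omits the bounded hull F_s(c(s, t]), which shrinks to
0 as t ↓ s. Quantitative estimates for such maps (`IsHullPair`) yield the Loewner equation ∂_t(f_t +
λ_t) = 2/f_t at points that are never swallowed, for all real t (`IsSlitChain.hasDerivAt_flow`).

Hence ∂_t f² = 4 - 2fλ' almost everywhere, and on [T, t] the quantity f² - 4t changes by at most 2
max|f| ∫|λ'|. The integral is at most √(t - T) times the root of the energy of λ beyond T, up to a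
constant. Together with the a priori bound |f_s|² = O(|z|² + t) for 0 ≤ s ≤ t, this makes the error
o(t) (`IsLoewnerFlow.sq_div_tendsto`).

For the derivative, λ cancels in f_t(z) - f_t(w), and ∂_t log|f_t(z) - f_t(w)|² = -(1/t) Re(4t /
(f_t(z) f_t(w))). By the first part this is -(1 + o(1))/t, so squared distances decay like
t^(-1+o(1)). Dividing by |z - w|² and letting w → z transfers the bounds to f_t' without
differentiating the flow in z (`IsLoewnerFlow.log_deriv_div_log_tendsto`).

As t → -∞, the family i f_{-t} satisfies the same flow estimates, with speed |λ'(-t)|. Both ends are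
therefore instances of `IsLoewnerFlow`. -/

theorem not_eventually_const_of_injOn (hV : IsOpen V) (hinj : InjOn F V) (hu : u ∈ V) :
    ¬ ∀ᶠ z in 𝓝 u, F z = F u := by
  intro h
  have h1 : ∀ᶠ z in 𝓝 u, z = u := by
    filter_upwards [h, hV.mem_nhds hu] with z hz hzV using hinj hzV hu hz
  have h2 : ∀ᶠ z in 𝓝[≠] u, False := by
    filter_upwards [h1.filter_mono nhdsWithin_le_nhds, self_mem_nhdsWithin] with z hz hz'
      using hz' hz
  rw [eventually_false_iff_eq_bot] at h2
  exact (inferInstance : (𝓝[≠] u).NeBot).ne h2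

theorem nhds_le_map_of_injOn (hV : IsOpen V) (hF : DifferentiableOn ℂ F V) (hinj : InjOn F V)
    (hu : u ∈ V) : 𝓝 (F u) ≤ map F (𝓝 u) :=
  ((hF.analyticAt (hV.mem_nhds hu)).eventually_constant_or_nhds_le_map_nhds_aux).resolve_left
    (not_eventually_const_of_injOn hV hinj hu)

theorem continuousAt_leftInverse (hV : IsOpen V) (hF : DifferentiableOn ℂ F V)
    (hinj : InjOn F V) (hG : ∀ v ∈ V, G (F v) = v) (hu : u ∈ V) : ContinuousAt G (F u) := by
  have h1 : Tendsto G (map F (𝓝 u)) (𝓝 u) := by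
    rw [tendsto_map'_iff]
    refine tendsto_id.congr' ?_
    filter_upwards [hV.mem_nhds hu] with v hv using (hG v hv).symm
  have h2 := h1.mono_left (nhds_le_map_of_injOn hV hF hinj hu)
  rwa [ContinuousAt, hG u hu]

/-- By the identity theorem the only alternative is that the derivative vanishes near `u`; then `F`
is constant on a ball, against injectivity. -/
theorem eventually_deriv_ne_zero_of_injOn (hV : IsOpen V) (hF : DifferentiableOn ℂ F V)
    (hinj : InjOn F V) (hu : u ∈ V) : ∀ᶠ v in 𝓝[≠] u, deriv F v ≠ 0 := by
  have hA := (hF.analyticAt (hV.mem_nhds hu)).deriv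
  refine hA.eventually_eq_zero_or_eventually_ne_zero.resolve_left fun h => ?_
  refine not_eventually_const_of_injOn hV hinj hu ?_
  obtain ⟨r, hr, hb⟩ := Metric.eventually_nhds_iff_ball.1 (h.and (hV.mem_nhds hu))
  filter_upwards [Metric.ball_mem_nhds u hr] with z hz
  refine (convex_ball u r).is_const_of_fderivWithin_eq_zero (𝕜 := ℂ)
    (hF.mono fun w hw => (hb w hw).2) (fun w hw => ?_) hz (Metric.mem_ball_self hr)
  rw [fderivWithin_of_isOpen Metric.isOpen_ball hw]
  ext
  simpa using (hb w hw).1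

/-- Zeros of the derivative are isolated, so the inverse rule applies on a punctured neighbourhood
of `F u`, and continuity of `G` makes the puncture removable. Nonvanishing of the derivative at `u`
is not assumed; `deriv_ne_zero_of_injOn` deduces it from this. -/
theorem differentiableAt_leftInverse (hV : IsOpen V) (hF : DifferentiableOn ℂ F V)
    (hinj : InjOn F V) (hG : ∀ v ∈ V, G (F v) = v) (hu : u ∈ V) :
    DifferentiableAt ℂ G (F u) := by
  have hFG : ∀ v ∈ V, ∀ᶠ z in 𝓝 (F v), G z ∈ V ∧ F (G z) = z := by
    intro v hv
    refine nhds_le_map_of_injOn hV hF hinj hv ?_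
    rw [mem_map]
    filter_upwards [hV.mem_nhds hv] with x hx
    simp only [mem_preimage, mem_ofPred_eq]
    rw [hG x hx]
    exact ⟨hx, rfl⟩
  refine (Complex.analyticAt_of_differentiable_on_punctured_nhds_of_continuousAt ?_
    (continuousAt_leftInverse hV hF hinj hG hu)).differentiableAt
  have hc := continuousAt_leftInverse hV hF hinj hG hu
  have h1 : Tendsto G (𝓝[≠] (F u)) (𝓝[≠] u) := by
    refine tendsto_nhdsWithin_iff.2 ⟨?_, ?_⟩
    · have := hc.tendsto
      rw [hG u hu] at this
      exact this.mono_left nhdsWithin_le_nhds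
    · filter_upwards [(hFG u hu).filter_mono nhdsWithin_le_nhds, self_mem_nhdsWithin] with z hz hz'
      intro h
      apply hz'
      rw [← hz.2, mem_singleton_iff.1 h]
      rfl
  filter_upwards [h1.eventually (eventually_deriv_ne_zero_of_injOn hV hF hinj hu),
    (hFG u hu).filter_mono nhdsWithin_le_nhds] with z hz hz'
  obtain ⟨hzV, hzF⟩ := hz'
  have hcz := continuousAt_leftInverse hV hF hinj hG hzV
  rw [hzF] at hcz
  have hev := hFG _ hzV
  rw [hzF] at hev
  exact (HasDerivAt.of_local_left_inverse hcz
    (hF.differentiableAt (hV.mem_nhds hzV)).hasDerivAt hz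
    (hev.mono fun _ h => h.2)).differentiableAt

theorem deriv_ne_zero_of_injOn (hV : IsOpen V) (hF : DifferentiableOn ℂ F V)
    (hinj : InjOn F V) (hu : u ∈ V) : deriv F u ≠ 0 := by
  have hG : ∀ v ∈ V, Function.invFunOn F V (F v) = v := fun v hv =>
    hinj.leftInvOn_invFunOn hv
  have hd := (differentiableAt_leftInverse hV hF hinj hG hu).hasDerivAt
  have h1 := hd.comp u (hF.differentiableAt (hV.mem_nhds hu)).hasDerivAt
  have h2 : HasDerivAt (Function.invFunOn F V ∘ F) 1 u :=
    (hasDerivAt_id u).congr_of_eventuallyEq (by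
      filter_upwards [hV.mem_nhds hu] with v hv using hG v hv)
  have := h1.unique h2
  intro h0
  rw [h0, mul_zero] at this
  exact zero_ne_one this

end Inverse

/-! ### A maximum principle for imaginary parts -/

theorem isOpen_upperHalf : IsOpen upperHalf := isOpen_lt continuous_const Complex.continuous_im

/-- A holomorphic function on an open set whose imaginary part has boundary values at most `0`,
including at infinity, has nonpositive imaginary part. -/
theorem im_nonpos_of_boundary {U : Set ℂ} (hU : IsOpen U) {F : ℂ → ℂ}
    (hF : DifferentiableOn ℂ F U)
    (hfr : ∀ x ∈ frontier U, ∀ η > 0, ∀ᶠ z in 𝓝[U] x, (F z).im ≤ η)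
    (hinf : ∀ η > 0, ∃ R : ℝ, ∀ z ∈ U, R < ‖z‖ → (F z).im ≤ η) :
    ∀ z ∈ U, (F z).im ≤ 0 := by
  intro z₀ hz₀
  by_contra! hm
  set m := (F z₀).im with hmdef
  have hFc : ContinuousOn (fun z => (F z).im) U := Complex.continuous_im.comp_continuousOn
    hF.continuousOn
  set S : Set ℂ := {z | z ∈ U ∧ m ≤ (F z).im} with hS
  have hSU : S ⊆ U := fun z hz => hz.1
  have hScl : IsClosed S := by
    refine isClosed_of_closure_subset fun x hx => ?_
    have hxU : x ∈ closure U := closure_mono hSU hx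
    have hxin : x ∈ U := by
      by_contra hxU'
      have hxf : x ∈ frontier U := by
        rw [frontier, hU.interior_eq]; exact ⟨hxU, hxU'⟩
      have h1 := hfr x hxf (m / 2) (by linarith)
      have h2 : ∃ᶠ z in 𝓝 x, z ∈ S := mem_closure_iff_frequently.1 hx
      rw [eventually_nhdsWithin_iff] at h1
      obtain ⟨z, hz, hz'⟩ := (h2.and_eventually h1).exists
      have := hz' hz.1
      have := hz.2
      linarith
    refine ⟨hxin, ?_⟩
    have hc := hFc.continuousAt (hU.mem_nhds hxin)
    refine ge_of_tendsto_of_frequently hc.tendsto ?_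
    exact (mem_closure_iff_frequently.1 hx).mono fun z hz => hz.2
  have hSc : IsCompact S := by
    obtain ⟨R, hR⟩ := hinf (m / 2) (by linarith)
    refine Metric.isCompact_of_isClosed_isBounded hScl
      ((Metric.isBounded_closedBall (x := (0 : ℂ)) (r := R)).subset fun z hz => ?_)
    rw [mem_closedBall_zero_iff]
    by_contra! h
    have := hR z hz.1 h
    have := hz.2
    linarith
  obtain ⟨z₁, hz₁, hmax⟩ := hSc.exists_isMaxOn ⟨z₀, hz₀, le_rfl⟩ (hFc.mono hSU)
  -- The set of maximum points is open, because exp(-iF) has modulus exp(Im F) and obeys the strong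
  -- maximum principle. Being also closed and nonempty it is all of ℂ, yet it lies in a compact set.
  set T : Set ℂ := {z | z ∈ S ∧ (F z).im = (F z₁).im} with hT
  have hTcl : IsClosed T := by
    have : T = S ∩ (fun z => (F z).im) ⁻¹' {(F z₁).im} := rfl
    rw [this]
    exact (hFc.mono hSU).preimage_isClosed_of_isClosed hScl isClosed_singleton
  have hTo : IsOpen T := by
    rw [isOpen_iff_mem_nhds]
    intro z hz
    have hzU := hSU hz.1
    have hd : ∀ᶠ w in 𝓝 z, DifferentiableAt ℂ (fun w => Complex.exp (-Complex.I * F w)) w := by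
      filter_upwards [hU.mem_nhds hzU] with w hw
      exact ((hF.differentiableAt (hU.mem_nhds hw)).const_mul _).cexp
    have hn : ∀ w, ‖Complex.exp (-Complex.I * F w)‖ = Real.exp (F w).im := by
      intro w; rw [Complex.norm_exp]; simp
    have hle : ∀ w ∈ U, (F w).im ≤ (F z).im := by
      intro w hw
      rw [hz.2]
      by_cases h : m ≤ (F w).im
      · exact hmax ⟨hw, h⟩
      · exact (not_le.1 h).le.trans hz₁.2
    have hl : IsLocalMax (norm ∘ fun w => Complex.exp (-Complex.I * F w)) z := by
      filter_upwards [hU.mem_nhds hzU] with w hw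
      simp only [Function.comp, hn]
      exact Real.exp_le_exp.2 (hle w hw)
    filter_upwards [Complex.eventually_eq_of_isLocalMax_norm hd hl, hU.mem_nhds hzU] with w hw hwU
    have h1 : (F w).im = (F z).im := by
      have := congrArg norm hw
      rw [hn, hn] at this
      exact Real.exp_injective this
    refine ⟨⟨hwU, ?_⟩, h1.trans hz.2⟩
    rw [h1, hz.2]
    exact hz₁.2
  have hTu : T = univ := IsClopen.eq_univ ⟨hTcl, hTo⟩ ⟨z₁, hz₁, rfl⟩
  have hTc : IsCompact T := hSc.of_isClosed_subset hTcl fun z hz => hz.1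
  rw [hTu] at hTc
  exact noncompact_univ ℂ hTc

/-! ### The outer half-disc -/

theorem isPreconnected_outerHalf (R : ℝ) : IsPreconnected {z : ℂ | 0 < z.im ∧ R < ‖z‖} := by
  rcases lt_or_ge R 0 with hR | hR
  · have : {z : ℂ | 0 < z.im ∧ R < ‖z‖} = {z : ℂ | 0 < z.im} := by
      ext z; simp only [mem_ofPred_eq, and_iff_left_iff_imp]
      intro _; exact hR.trans_le (norm_nonneg z)
    rw [this]
    exact (convex_halfSpace_im_gt 0).isPreconnected
  · have hpol : {z : ℂ | 0 < z.im ∧ R < ‖z‖} =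
        (fun p : ℝ × ℝ => (p.1 : ℂ) * Complex.exp (p.2 * Complex.I)) ''
          (Ioi R ×ˢ Ioo 0 Real.pi) := by
      ext z
      constructor
      · rintro ⟨h1, h2⟩
        refine ⟨(‖z‖, z.arg), ⟨h2, ?_, ?_⟩, Complex.norm_mul_exp_arg_mul_I z⟩
        · refine lt_of_le_of_ne (Complex.arg_nonneg_iff.2 h1.le) fun h => ?_
          have := (Complex.arg_eq_zero_iff.1 h.symm).2
          linarith
        · exact Complex.arg_lt_pi_iff.2 (Or.inr h1.ne')
      · rintro ⟨⟨r, θ⟩, ⟨hr, hθ⟩, rfl⟩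
        have hr' : R < r := hr
        have hr0 : 0 < r := hR.trans_lt hr'
        refine ⟨?_, ?_⟩
        · simp only [Complex.im_ofReal_mul, Complex.exp_ofReal_mul_I_im]
          exact mul_pos hr0 (Real.sin_pos_of_mem_Ioo hθ)
        · simpa [abs_of_pos hr0] using hr'
    rw [hpol]
    refine IsPreconnected.image ?_ _ (by fun_prop)
    exact ((convex_Ioi R).prod (convex_Ioo 0 Real.pi)).isPreconnected

/-- A continuous function on an outer half-disc which never has modulus `R₁` and has modulus
larger than `R₁` somewhere has modulus larger than `R₁` everywhere. -/
theorem lt_norm_of_norm_ne {g : ℂ → ℂ} {R R₁ : ℝ}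
    (hg : ContinuousOn g {z : ℂ | 0 < z.im ∧ R < ‖z‖})
    (hne : ∀ z : ℂ, 0 < z.im → R < ‖z‖ → ‖g z‖ ≠ R₁) {z₀ : ℂ} (hz₀ : 0 < z₀.im)
    (hz₀' : R < ‖z₀‖) (h₀ : R₁ < ‖g z₀‖) {z : ℂ} (hz : 0 < z.im) (hz' : R < ‖z‖) :
    R₁ < ‖g z‖ := by
  by_contra! h
  obtain ⟨w, hw, hw'⟩ := (isPreconnected_outerHalf R).intermediate_value (f := fun z => ‖g z‖)
    (a := z) (b := z₀) ⟨hz, hz'⟩ ⟨hz₀, hz₀'⟩ hg.norm ⟨h, h₀.le⟩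
  exact hne w hw.1 hw.2 hw'

/-! ### Growth estimates -/

/-- Borel–Carathéodory for i(F(z₀ + w) - F(z₀)), whose real part is the drop of Im F. -/
theorem norm_sub_le_of_im_le {F : ℂ → ℂ} {z₀ z : ℂ} {M R : ℝ} (hM : 0 < M)
    (hF : DifferentiableOn ℂ F (Metric.ball z₀ R))
    (hb : ∀ w ∈ Metric.ball z₀ R, (F z₀).im - (F w).im ≤ M) (hz : z ∈ Metric.ball z₀ R) :
    ‖F z - F z₀‖ ≤ 2 * M * ‖z - z₀‖ / (R - ‖z - z₀‖) := by
  have hR : 0 < R := Metric.pos_of_mem_ball hz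
  have hsh : ∀ w ∈ Metric.ball (0 : ℂ) R, z₀ + w ∈ Metric.ball z₀ R := by
    intro w hw; simpa using hw
  have := Complex.borelCaratheodory_zero (f := fun w => Complex.I * (F (z₀ + w) - F z₀))
    (z := z - z₀) (R := R) hM ?_ ?_ hR ?_ ?_
  · simpa using this
  · refine DifferentiableOn.const_mul (DifferentiableOn.sub_const ?_ _) _
    exact hF.comp (by fun_prop) hsh
  · intro w hw
    have := hb _ (hsh w hw)
    simpa using this
  · simpa [dist_eq_norm] using hz
  · simp

theorem norm_deriv_le_of_im_le {F : ℂ → ℂ} {z₀ : ℂ} {M R : ℝ} (hM : 0 < M) (hR : 0 < R)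
    (hF : DifferentiableOn ℂ F (Metric.ball z₀ R))
    (hb : ∀ w ∈ Metric.ball z₀ R, (F z₀).im - (F w).im ≤ M) :
    ‖deriv F z₀‖ ≤ 4 * M / R := by
  refine norm_deriv_le_of_lip' (by positivity) ?_
  filter_upwards [Metric.ball_mem_nhds z₀ (half_pos hR)] with z hz
  have hz2 : ‖z - z₀‖ < R / 2 := by simpa [dist_eq_norm] using hz
  refine (norm_sub_le_of_im_le hM hF hb (Metric.ball_subset_ball (by linarith) hz)).trans ?_
  rw [div_mul_eq_mul_div, div_le_div_iff₀ (by linarith) hR]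
  have h0 : 0 ≤ 2 * M * ‖z - z₀‖ := by positivity
  nlinarith

/-- A Nevanlinna function which decays like `m / Y` along a vertical ray. -/
theorem norm_le_div_im {F : ℂ → ℂ} {m : ℝ} (hm : 0 < m) (hF : DifferentiableOn ℂ F upperHalf)
    (hpos : ∀ z ∈ upperHalf, 0 ≤ (F z).im)
    (hlim : ∀ x : ℝ, Tendsto (fun Y : ℝ => F (x + Y * Complex.I)) atTop (𝓝 0))
    (hdec : ∀ x : ℝ, ∀ᶠ Y : ℝ in atTop, (F (x + Y * Complex.I)).im ≤ m / Y)
    {z : ℂ} (hz : z ∈ upperHalf) : ‖F z‖ ≤ 2 * m / z.im := by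
  have hz' : 0 < z.im := hz
  -- The disc of radius Y about the point at height Y lies in the half-plane, and there Im F drops
  -- by at most m/Y. The point z has distance Im z from the boundary circle, so the factor Y
  -- cancels; the value at the centre dies as Y → ∞.
  have key : ∀ᶠ Y : ℝ in atTop, ‖F z‖ ≤ ‖F (z.re + Y * Complex.I)‖ + 2 * m / z.im := by
    filter_upwards [hdec z.re, eventually_gt_atTop z.im] with Y hY hYz
    have hY0 : 0 < Y := hz'.trans hYz
    set z₀ : ℂ := z.re + Y * Complex.I with hz₀
    have him : z₀.im = Y := by simp [hz₀]
    have hnorm : ‖z - z₀‖ = Y - z.im := by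
      have : z - z₀ = ((z.im - Y : ℝ) : ℂ) * Complex.I := by
        apply Complex.ext <;> simp [hz₀]
      rw [this, norm_mul, Complex.norm_I, mul_one, Complex.norm_real, Real.norm_eq_abs,
        abs_of_neg (by linarith)]
      ring
    have hball : Metric.ball z₀ Y ⊆ upperHalf := by
      intro w hw
      have h1 : ‖w - z₀‖ < Y := by simpa [dist_eq_norm] using hw
      have h2 := (Complex.abs_im_le_norm (w - z₀)).trans_lt h1
      rw [Complex.sub_im, him, abs_lt] at h2
      show 0 < w.im
      linarith [h2.1]
    have h := norm_sub_le_of_im_le (F := F) (z₀ := z₀) (z := z) (M := m / Y) (R := Y)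
      (by positivity) (hF.mono hball)
      (fun w hw => by have := hpos w (hball hw); linarith)
      (by rw [Metric.mem_ball, dist_eq_norm, hnorm]; linarith)
    rw [hnorm] at h
    have h3 : 2 * (m / Y) * (Y - z.im) / (Y - (Y - z.im)) ≤ 2 * m / z.im := by
      rw [sub_sub_cancel]
      refine div_le_div_of_nonneg_right ?_ hz'.le
      rw [mul_assoc, div_mul_eq_mul_div]
      refine mul_le_mul_of_nonneg_left ?_ (by norm_num)
      rw [div_le_iff₀ hY0]
      nlinarith
    have h4 := norm_le_norm_add_norm_sub' (F z) (F z₀)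
    linarith
  have hl : Tendsto (fun Y : ℝ => ‖F (z.re + Y * Complex.I)‖ + 2 * m / z.im) atTop
      (𝓝 (2 * m / z.im)) := by
    simpa using (hlim z.re).norm.add_const (2 * m / z.im)
  exact ge_of_tendsto hl key

/-- Integration of the bound from 1 to infinity, with B(1 - 1/r) as comparison function. -/
theorem norm_le_of_norm_deriv_le_div_sq {h h' : ℝ → ℂ} {B : ℝ}
    (hd : ∀ r : ℝ, 1 ≤ r → HasDerivAt h (h' r) r) (hb : ∀ r : ℝ, 1 ≤ r → ‖h' r‖ ≤ B / r ^ 2)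
    (hlim : Tendsto h atTop (𝓝 0)) : ‖h 1‖ ≤ B := by
  have hB : 0 ≤ B := by simpa using (norm_nonneg _).trans (hb 1 le_rfl)
  have key : ∀ᶠ r : ℝ in atTop, ‖h r - h 1‖ ≤ B := by
    filter_upwards [eventually_ge_atTop 1] with r hr
    have h1 := image_norm_le_of_norm_deriv_right_le_deriv_boundary'
      (f := fun s => h s - h 1) (a := 1) (b := r) (f' := h')
      (B := fun s => B * (1 - s⁻¹)) (B' := fun s => B / s ^ 2)
      (fun s hs => ((hd s hs.1).continuousAt.sub continuousAt_const).continuousWithinAt)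
      (fun s hs => ((hd s hs.1).sub_const _).hasDerivWithinAt)
      (by simp)
      (fun s hs => by
        have : s ≠ 0 := by linarith [hs.1]
        exact ContinuousAt.continuousWithinAt (by fun_prop (disch := assumption)))
      (fun s hs => by
        have : s ≠ 0 := by linarith [hs.1]
        have h2 := ((hasDerivAt_inv this).const_sub 1).const_mul B
        refine HasDerivAt.hasDerivWithinAt (h2.congr_deriv ?_)
        rw [neg_neg, div_eq_mul_inv])
      (fun s hs => hb s hs.1)
      (right_mem_Icc.2 hr)
    refine h1.trans ?_
    have : 0 ≤ r⁻¹ := by positivity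
    nlinarith
  have hl : Tendsto (fun r => ‖h r - h 1‖) atTop (𝓝 ‖h 1‖) := by
    simpa using (hlim.sub_const (h 1)).norm
  exact le_of_tendsto hl key

/-! ### Conformal maps onto the half-plane minus a bounded hull -/

/-- `Φ` is a conformal map of the upper half-plane onto `B = ℍ ∖ K`, with `K` bounded, with inverse
`ψ` and expansion `Φ z = z + c - 2 a / z + O(1 / z²)` at infinity. -/
structure IsHullPair (Φ ψ : ℂ → ℂ) (B : Set ℂ) (c a : ℝ) : Prop where
  subset : B ⊆ upperHalf
  differentiableOn : DifferentiableOn ℂ Φ upperHalf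
  differentiableOn_inv : DifferentiableOn ℂ ψ B
  mapsTo : MapsTo Φ upperHalf B
  mapsTo_inv : MapsTo ψ B upperHalf
  left_inv : ∀ z ∈ upperHalf, ψ (Φ z) = z
  right_inv : ∀ ζ ∈ B, Φ (ψ ζ) = ζ
  pos : 0 < a
  mem_of_lt : ∃ R : ℝ, ∀ ζ ∈ upperHalf, R < ‖ζ‖ → ζ ∈ B
  expansion : ∃ C R : ℝ, ∀ z ∈ upperHalf, R < ‖z‖ → ‖Φ z - (z + c - 2 * a / z)‖ ≤ C / ‖z‖ ^ 2

theorem norm_ofReal_mul_I_mem {Y : ℝ} (hY : 0 < Y) :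
    (Y * Complex.I : ℂ) ∈ upperHalf ∧ ‖(Y * Complex.I : ℂ)‖ = Y := by
  refine ⟨?_, ?_⟩
  · show 0 < (Y * Complex.I : ℂ).im
    simpa using hY
  · simp [abs_of_pos hY]

theorem norm_pos_of_mem_upperHalf {z : ℂ} (hz : z ∈ upperHalf) : 0 < ‖z‖ := by
  have h : 0 < z.im := hz
  exact h.trans_le ((le_abs_self _).trans (Complex.abs_im_le_norm z))

theorem im_eq_zero_of_mem_frontier_upperHalf {x : ℂ} (hx : x ∈ frontier upperHalf) :
    x.im = 0 := by
  have : frontier upperHalf = {z : ℂ | z.im = 0} := Complex.frontier_setOfPred_lt_im 0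
  rw [this] at hx
  exact hx

namespace IsHullPair

variable {Φ ψ : ℂ → ℂ} {B : Set ℂ} {c a : ℝ}

theorem expansion' (h : IsHullPair Φ ψ B c a) : ∃ C R : ℝ, 0 < C ∧ 1 ≤ R ∧
    ∀ z ∈ upperHalf, R < ‖z‖ → ‖Φ z - z - c + 2 * a / z‖ ≤ C / ‖z‖ ^ 2 := by
  obtain ⟨C, R, hC⟩ := h.expansion
  refine ⟨|C| + 1, max R 1, by positivity, le_max_right _ _, fun z hz hzR => ?_⟩
  have := hC z hz ((le_max_left _ _).trans_lt hzR)
  have e : Φ z - z - c + 2 * a / z = Φ z - (z + c - 2 * a / z) := by ring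
  rw [e]
  refine this.trans ?_
  gcongr
  linarith [le_abs_self C]

theorem norm_sub_sub_le (h : IsHullPair Φ ψ B c a) : ∃ C R : ℝ, 0 < C ∧ 1 ≤ R ∧
    ∀ z ∈ upperHalf, R < ‖z‖ → ‖Φ z - z - c‖ ≤ C / ‖z‖ := by
  obtain ⟨C, R, hC0, hR1, hC⟩ := h.expansion'
  have ha := h.pos
  refine ⟨C + 2 * a, R, by positivity, hR1, fun z hz hzR => ?_⟩
  have hz0 := norm_pos_of_mem_upperHalf hz
  have h1 := hC z hz hzR
  have h2 : ‖(2 * a / z : ℂ)‖ = 2 * a / ‖z‖ := by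
    rw [norm_div, norm_mul, Complex.norm_real, Real.norm_eq_abs, abs_of_pos ha]; simp
  have h3 : C / ‖z‖ ^ 2 ≤ C / ‖z‖ := by
    gcongr
    have : 1 ≤ ‖z‖ := by linarith
    nlinarith
  calc ‖Φ z - z - c‖ = ‖(Φ z - z - c + 2 * a / z) - 2 * a / z‖ := by ring_nf
    _ ≤ C / ‖z‖ + 2 * a / ‖z‖ := (norm_sub_le _ _).trans (by rw [h2]; linarith)
    _ = (C + 2 * a) / ‖z‖ := by ring

/-- The expansion controls `Φ` only; this is properness of the inverse at infinity. Far out `Φ`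
moves points by at most |c| + C, so |ψ ζ| = R₁ forces |ζ| ≤ R₁ + |c| + C. Beyond that radius the
modulus R₁ is never taken, and the image of a high point iY decides on which side |ψ| lies. -/
theorem lt_norm_inv (h : IsHullPair Φ ψ B c a) (R : ℝ) :
    ∃ R' : ℝ, ∀ ζ ∈ upperHalf, R' < ‖ζ‖ → ζ ∈ B ∧ R < ‖ψ ζ‖ := by
  obtain ⟨C, R₀, hC0, hR1, hC⟩ := h.norm_sub_sub_le
  obtain ⟨RB, hRB⟩ := h.mem_of_lt
  set R₁ := max R (R₀ + 1)
  have hR₁ : R₀ < R₁ := by linarith [le_max_right R (R₀ + 1)]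
  set R' := max (R₁ + |c| + C) RB
  have hB : ∀ ζ ∈ upperHalf, R' < ‖ζ‖ → ζ ∈ B := fun ζ hζ hζ' =>
    hRB ζ hζ ((le_max_right _ _).trans_lt hζ')
  have hbd : ∀ z ∈ upperHalf, R₀ < ‖z‖ → ‖Φ z - z‖ ≤ |c| + C := by
    intro z hz hzR
    have h1 := hC z hz hzR
    have h2 : C / ‖z‖ ≤ C := div_le_self hC0.le (by linarith)
    calc ‖Φ z - z‖ = ‖(Φ z - z - c) + c‖ := by ring_nf
      _ ≤ ‖Φ z - z - c‖ + ‖(c : ℂ)‖ := norm_add_le _ _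
      _ ≤ |c| + C := by rw [Complex.norm_real, Real.norm_eq_abs]; linarith
  refine ⟨R', fun ζ hζ hζ' => ⟨hB ζ hζ hζ', (le_max_left R (R₀ + 1)).trans_lt ?_⟩⟩
  obtain ⟨Y, hY1, hY2, hY3⟩ : ∃ Y : ℝ, R₁ < Y ∧ R' + |c| + C < Y ∧ 0 < Y :=
    ((eventually_gt_atTop R₁).and ((eventually_gt_atTop _).and (eventually_gt_atTop 0))).exists
  obtain ⟨hYm, hYn⟩ := norm_ofReal_mul_I_mem hY3
  refine lt_norm_of_norm_ne (g := ψ) (R := R') (R₁ := R₁) (z₀ := Φ (Y * Complex.I)) ?_ ?_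
    (h.subset (h.mapsTo hYm)) ?_ ?_ hζ hζ'
  · exact h.differentiableOn_inv.continuousOn.mono fun z hz => hB z hz.1 hz.2
  · intro z hz hzR hn
    have hzB := hB z hz hzR
    have h1 := hbd (ψ z) (h.mapsTo_inv hzB) (by rw [hn]; exact hR₁)
    rw [h.right_inv z hzB] at h1
    have h2 := norm_le_norm_add_norm_sub' z (ψ z)
    have h3 := le_max_left (R₁ + |c| + C) RB
    rw [hn] at h2
    change R' < _ at hzR
    linarith
  · have h1 := hbd _ hYm (by rw [hYn]; linarith)
    have h2 := norm_le_norm_add_norm_sub (Φ (Y * Complex.I)) (Y * Complex.I)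
    rw [hYn] at h2
    linarith
  · rw [h.left_inv _ hYm, hYn]; exact hY1

theorem norm_bounded (h : IsHullPair Φ ψ B c a) (R : ℝ) :
    ∃ R' : ℝ, ∀ z ∈ upperHalf, ‖z‖ ≤ R → ‖Φ z‖ ≤ R' := by
  obtain ⟨R', hR'⟩ := h.lt_norm_inv R
  refine ⟨R', fun z hz hzR => ?_⟩
  by_contra! hlt
  have := (hR' (Φ z) (h.subset (h.mapsTo hz)) hlt).2
  rw [h.left_inv z hz] at this
  linarith

theorem norm_sub_inv_le (h : IsHullPair Φ ψ B c a) {η : ℝ} (hη : 0 < η) :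
    ∃ R' : ℝ, ∀ ζ ∈ upperHalf, R' < ‖ζ‖ → ‖ζ - ψ ζ - c‖ ≤ η := by
  obtain ⟨C, R₀, hC0, hR1, hC⟩ := h.norm_sub_sub_le
  obtain ⟨R', hR'⟩ := h.lt_norm_inv (max R₀ (C / η))
  refine ⟨R', fun ζ hζ hζR => ?_⟩
  obtain ⟨hB, hlt⟩ := hR' ζ hζ hζR
  have h1 := hC (ψ ζ) (h.mapsTo_inv hB) ((le_max_left _ _).trans_lt hlt)
  rw [h.right_inv ζ hB] at h1
  refine h1.trans ?_
  have h2 : C / η < ‖ψ ζ‖ := (le_max_right _ _).trans_lt hlt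
  rw [div_lt_iff₀ hη] at h2
  rw [div_le_iff₀ (norm_pos_of_mem_upperHalf (h.mapsTo_inv hB))]
  linarith

/-- Maximum principle for z - Φ(z) + c: near the real line Im z is small and Im Φ is positive, and
the function tends to 0 at infinity. -/
theorem im_le (h : IsHullPair Φ ψ B c a) {z : ℂ} (hz : z ∈ upperHalf) : z.im ≤ (Φ z).im := by
  have key := im_nonpos_of_boundary isOpen_upperHalf (F := fun z => z - Φ z + c)
    ((differentiableOn_id.sub h.differentiableOn).add_const _) ?_ ?_ z hz
  · simp only [Complex.add_im, Complex.sub_im, Complex.ofReal_im] at key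
    linarith
  · intro x hx η hη
    have hx0 := im_eq_zero_of_mem_frontier_upperHalf hx
    have h1 : ∀ᶠ z : ℂ in 𝓝 x, z.im < η :=
      Complex.continuous_im.continuousAt.eventually_lt continuousAt_const (by rw [hx0]; exact hη)
    filter_upwards [h1.filter_mono nhdsWithin_le_nhds, self_mem_nhdsWithin] with w hw hwU
    have h2 : 0 < (Φ w).im := h.subset (h.mapsTo hwU)
    simp only [Complex.add_im, Complex.sub_im, Complex.ofReal_im]
    linarith
  · intro η hη
    obtain ⟨C, R₀, hC0, hR1, hC⟩ := h.norm_sub_sub_le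
    refine ⟨max R₀ (C / η), fun w hw hwR => ?_⟩
    have h1 := hC w hw ((le_max_left _ _).trans_lt hwR)
    have h2 : C / η < ‖w‖ := (le_max_right _ _).trans_lt hwR
    have h3 : C / ‖w‖ ≤ η := by
      rw [div_lt_iff₀ hη] at h2
      rw [div_le_iff₀ (norm_pos_of_mem_upperHalf hw)]
      linarith
    have h4 := (Complex.abs_im_le_norm (Φ w - w - c))
    have h5 := neg_abs_le (Φ w - w - c).im
    simp only [Complex.sub_im, Complex.add_im, Complex.ofReal_im] at h4 h5 ⊢
    linarith

/-! ### Hulls contained in the disc of radius δ -/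

section Small

variable {δ : ℝ}

theorem im_inv_le (h : IsHullPair Φ ψ B c a) {ζ : ℂ} (hζ : ζ ∈ B) : (ψ ζ).im ≤ ζ.im := by
  have := h.im_le (h.mapsTo_inv hζ)
  rwa [h.right_inv ζ hζ] at this

/-- Comparison with the Joukowski map z + δ²/z, which is real on the semicircle of radius δ: adding
δ²/z to z - ψ(z) - c makes the boundary values of the imaginary part nonpositive. -/
theorem im_sub_im_inv_le (h : IsHullPair Φ ψ B c a) (hδ : 0 < δ)
    (hB : ∀ ζ ∈ upperHalf, δ < ‖ζ‖ → ζ ∈ B) {ζ : ℂ} (hζ : ζ ∈ upperHalf) (hζδ : δ < ‖ζ‖) :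
    ζ.im - (ψ ζ).im ≤ δ ^ 2 * ζ.im / ‖ζ‖ ^ 2 := by
  set U : Set ℂ := {z : ℂ | z ∈ upperHalf ∧ δ < ‖z‖} with hUdef
  have hU : IsOpen U := isOpen_upperHalf.inter (isOpen_lt continuous_const continuous_norm)
  have hUB : U ⊆ B := fun z hz => hB z hz.1 hz.2
  set F : ℂ → ℂ := fun z => z - ψ z - c + (δ : ℂ) ^ 2 / z with hFdef
  have hFim : ∀ z, (F z).im = z.im - (ψ z).im - δ ^ 2 * z.im / ‖z‖ ^ 2 := by
    intro z
    have : ((δ : ℂ) ^ 2 / z).im = - (δ ^ 2 * z.im / ‖z‖ ^ 2) := by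
      rw [Complex.div_im, Complex.sq_norm, ← Complex.ofReal_pow, Complex.ofReal_im,
        Complex.ofReal_re]
      simp
    simp only [hFdef, Complex.add_im, Complex.sub_im, Complex.ofReal_im, this]
    ring
  have hFd : DifferentiableOn ℂ F U := by
    refine ((differentiableOn_id.sub (h.differentiableOn_inv.mono hUB)).sub_const _).add ?_
    refine DifferentiableOn.div (differentiableOn_const _) differentiableOn_id fun z hz => ?_
    exact norm_pos_iff.1 (norm_pos_of_mem_upperHalf hz.1)
  have key := im_nonpos_of_boundary hU hFd ?_ ?_ ζ ⟨hζ, hζδ⟩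
  · rw [hFim] at key; linarith
  · intro x hx η hη
    have hxc : x ∈ {z : ℂ | 0 ≤ z.im ∧ δ ≤ ‖z‖} := by
      have hcl : IsClosed {z : ℂ | 0 ≤ z.im ∧ δ ≤ ‖z‖} :=
        (isClosed_le continuous_const Complex.continuous_im).inter
          (isClosed_le continuous_const continuous_norm)
      refine closure_minimal (fun z hz => ?_) hcl hx.1
      exact ⟨le_of_lt hz.1, hz.2.le⟩
    have hxU : x ∉ U := by
      have := hx.2
      rwa [hU.interior_eq] at this
    have hxn : 0 < ‖x‖ := hδ.trans_le hxc.2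
    have hx0 : x.im - δ ^ 2 * x.im / ‖x‖ ^ 2 = 0 := by
      rcases hxc.1.eq_or_lt with h0 | h0
      · rw [← h0]; simp
      · have h1 : ‖x‖ = δ := by
          refine le_antisymm ?_ hxc.2
          by_contra! h2
          exact hxU ⟨h0, h2⟩
        rw [h1]; field_simp; simp
    have hcont : ContinuousAt (fun z : ℂ => z.im - δ ^ 2 * z.im / ‖z‖ ^ 2) x := by
      have : ‖x‖ ^ 2 ≠ 0 := by positivity
      exact Complex.continuous_im.continuousAt.sub
        ((Complex.continuous_im.continuousAt.const_mul _).div (continuous_norm.pow 2).continuousAt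
          this)
    have h1 : ∀ᶠ z : ℂ in 𝓝 x, z.im - δ ^ 2 * z.im / ‖z‖ ^ 2 < η :=
      hcont.eventually_lt continuousAt_const (by rw [hx0]; exact hη)
    filter_upwards [h1.filter_mono nhdsWithin_le_nhds, self_mem_nhdsWithin] with w hw hwU
    have h2 : 0 < (ψ w).im := h.mapsTo_inv (hUB hwU)
    rw [hFim]
    linarith
  · intro η hη
    obtain ⟨R', hR'⟩ := h.norm_sub_inv_le hη
    refine ⟨R', fun w hw hwR => ?_⟩
    have h1 := (Complex.abs_im_le_norm _).trans (hR' w hw.1 hwR)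
    have h2 := le_abs_self (w - ψ w - c).im
    have h3 : 0 < w.im := hw.1
    have h4 : 0 ≤ δ ^ 2 * w.im / ‖w‖ ^ 2 := by positivity
    simp only [Complex.sub_im, Complex.ofReal_im] at h1 h2
    rw [hFim]
    linarith

/-- On the disc of radius Im z / 2 the imaginary part of z - ψ(z) drops by at most δ² Im z / |z|².
Im z cancels in the resulting derivative bound, leaving 8δ²/|z|², which is integrated along the ray
through ζ to infinity. -/
theorem norm_sub_inv_sub_le (h : IsHullPair Φ ψ B c a) (hδ : 0 < δ)
    (hB : ∀ ζ ∈ upperHalf, δ < ‖ζ‖ → ζ ∈ B) {ζ : ℂ} (hζ : ζ ∈ upperHalf)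
    (hζδ : 2 * δ ≤ ‖ζ‖) : ‖ζ - ψ ζ - c‖ ≤ 8 * δ ^ 2 / ‖ζ‖ := by
  set F : ℂ → ℂ := fun z => z - ψ z - c with hFdef
  have hζ0 := norm_pos_of_mem_upperHalf hζ
  have hball : ∀ z ∈ upperHalf, 2 * δ ≤ ‖z‖ → Metric.ball z (z.im / 2) ⊆ B := by
    intro z hz hzδ w hw
    have hz' : 0 < z.im := hz
    have h1 : ‖w - z‖ < z.im / 2 := by simpa [dist_eq_norm] using hw
    have h2 := (Complex.abs_im_le_norm (w - z)).trans_lt h1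
    rw [Complex.sub_im, abs_lt] at h2
    have h3 := norm_le_norm_add_norm_sub w z
    have h4 := (le_abs_self _).trans (Complex.abs_im_le_norm z)
    refine hB w ?_ (by linarith)
    show 0 < w.im
    linarith [h2.1]
  have hFd : ∀ z ∈ upperHalf, 2 * δ ≤ ‖z‖ →
      DifferentiableOn ℂ F (Metric.ball z (z.im / 2)) := fun z hz hzδ =>
    (differentiableOn_id.sub (h.differentiableOn_inv.mono (hball z hz hzδ))).sub_const _
  have hder : ∀ z ∈ upperHalf, 2 * δ ≤ ‖z‖ → ‖deriv F z‖ ≤ 8 * δ ^ 2 / ‖z‖ ^ 2 := by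
    intro z hz hzδ
    have hz' : 0 < z.im := hz
    have hz0 := norm_pos_of_mem_upperHalf hz
    refine (norm_deriv_le_of_im_le (F := F) (M := δ ^ 2 * z.im / ‖z‖ ^ 2) (R := z.im / 2)
      (by positivity) (by positivity) (hFd z hz hzδ) fun w hw => ?_).trans (le_of_eq ?_)
    · have h1 := h.im_sub_im_inv_le hδ hB hz (by linarith)
      have h2 := h.im_inv_le (hball z hz hzδ hw)
      simp only [hFdef, Complex.sub_im, Complex.ofReal_im]
      linarith
    · field_simp; ring
  have hmem : ∀ r : ℝ, 1 ≤ r → (r * ζ : ℂ) ∈ upperHalf ∧ ‖(r * ζ : ℂ)‖ = r * ‖ζ‖ ∧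
      2 * δ ≤ ‖(r * ζ : ℂ)‖ := by
    intro r hr
    have hn : ‖(r * ζ : ℂ)‖ = r * ‖ζ‖ := by
      rw [norm_mul, Complex.norm_real, Real.norm_eq_abs, abs_of_pos (by linarith)]
    refine ⟨?_, hn, ?_⟩
    · show 0 < (r * ζ : ℂ).im
      rw [Complex.im_ofReal_mul]
      exact mul_pos (by linarith) hζ
    · rw [hn]; nlinarith
  have key := norm_le_of_norm_deriv_le_div_sq (h := fun r : ℝ => F (r * ζ))
    (h' := fun r : ℝ => deriv F (r * ζ) * ζ) (B := 8 * δ ^ 2 / ‖ζ‖) ?_ ?_ ?_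
  · simpa using key
  · intro r hr
    obtain ⟨h1, h2, h3⟩ := hmem r hr
    have h1' : 0 < (r * ζ : ℂ).im := h1
    have hd := ((hFd _ h1 h3).differentiableAt
      (Metric.ball_mem_nhds _ (half_pos h1'))).hasDerivAt
    have hl : HasDerivAt (fun w : ℂ => w * ζ) ζ (r : ℂ) := by
      simpa using (hasDerivAt_id (r : ℂ)).mul_const ζ
    exact (HasDerivAt.comp (r : ℂ) hd hl).comp_ofReal
  · intro r hr
    obtain ⟨h1, h2, h3⟩ := hmem r hr
    rw [norm_mul]
    refine (mul_le_mul_of_nonneg_right (hder _ h1 h3) (norm_nonneg _)).trans (le_of_eq ?_)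
    rw [h2]
    have : r ≠ 0 := by linarith
    field_simp
  · rw [Metric.tendsto_atTop]
    intro η hη
    obtain ⟨R', hR'⟩ := h.norm_sub_inv_le (half_pos hη)
    refine ⟨max 1 (|R'| / ‖ζ‖ + 1), fun r hr => ?_⟩
    obtain ⟨h1, h2, h3⟩ := hmem r ((le_max_left _ _).trans hr)
    have h4 : |R'| / ‖ζ‖ < r := by linarith [(le_max_right _ _).trans hr]
    rw [div_lt_iff₀ hζ0] at h4
    have h5 := hR' _ h1 (by rw [h2]; exact (le_abs_self _).trans_lt h4)
    rw [dist_zero_right]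
    linarith

/-- Where |Φ z| = 2δ the displacement bound is 4δ, hence |z| ≤ 6δ + |c|. Outside that radius the
modulus 2δ is therefore never taken, and connectedness together with a high point iY gives the
inequality. -/
theorem lt_norm_of_lt_norm (h : IsHullPair Φ ψ B c a) (hδ : 0 < δ)
    (hB : ∀ ζ ∈ upperHalf, δ < ‖ζ‖ → ζ ∈ B) {z : ℂ} (hz : z ∈ upperHalf)
    (hzδ : 6 * δ + |c| < ‖z‖) : 2 * δ < ‖Φ z‖ := by
  obtain ⟨C, R₀, hC0, hR1, hC⟩ := h.norm_sub_sub_le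
  obtain ⟨Y, hY1, hY2, hY3⟩ : ∃ Y : ℝ, R₀ < Y ∧ 6 * δ + |c| + C < Y ∧ 0 < Y :=
    ((eventually_gt_atTop R₀).and ((eventually_gt_atTop _).and (eventually_gt_atTop 0))).exists
  obtain ⟨hYm, hYn⟩ := norm_ofReal_mul_I_mem hY3
  refine lt_norm_of_norm_ne (g := Φ) (R := 6 * δ + |c|) (R₁ := 2 * δ) (z₀ := Y * Complex.I) ?_ ?_
    hYm (by rw [hYn]; linarith) ?_ hz hzδ
  · exact h.differentiableOn.continuousOn.mono fun w hw => hw.1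
  · intro w hw hwδ hn
    have hwB := h.mapsTo hw
    have h1 := h.norm_sub_inv_sub_le hδ hB (h.subset hwB) hn.ge
    rw [h.left_inv w hw, hn] at h1
    have h2 : 8 * δ ^ 2 / (2 * δ) = 4 * δ := by field_simp; ring
    rw [h2] at h1
    have h3 : ‖w‖ ≤ ‖Φ w‖ + ‖Φ w - w - c‖ + ‖(c : ℂ)‖ := by
      calc ‖w‖ = ‖Φ w - (Φ w - w - c) - c‖ := by ring_nf
        _ ≤ _ := (norm_sub_le _ _).trans (by gcongr; exact norm_sub_le _ _)
    rw [hn, Complex.norm_real, Real.norm_eq_abs] at h3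
    linarith
  · have h1 := hC _ hYm (by rw [hYn]; exact hY1)
    rw [hYn] at h1
    have h2 : C / Y ≤ C := div_le_self hC0.le (by linarith)
    have h3 : ‖(Y * Complex.I : ℂ)‖ ≤ ‖Φ (Y * Complex.I)‖ +
        ‖Φ (Y * Complex.I) - Y * Complex.I - c‖ + ‖(c : ℂ)‖ := by
      calc ‖(Y * Complex.I : ℂ)‖ =
          ‖Φ (Y * Complex.I) - (Φ (Y * Complex.I) - Y * Complex.I - c) - c‖ := by ring_nf
        _ ≤ _ := (norm_sub_le _ _).trans (by gcongr; exact norm_sub_le _ _)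
    rw [hYn, Complex.norm_real, Real.norm_eq_abs] at h3
    linarith

theorem im_le_of_lt_norm (h : IsHullPair Φ ψ B c a) (hδ : 0 < δ)
    (hB : ∀ ζ ∈ upperHalf, δ < ‖ζ‖ → ζ ∈ B) {z : ℂ} (hz : z ∈ upperHalf)
    (hzδ : 6 * δ + |c| < ‖z‖) : (Φ z).im ≤ 4 / 3 * z.im := by
  have h1 := h.lt_norm_of_lt_norm hδ hB hz hzδ
  have hΦ := h.subset (h.mapsTo hz)
  have hΦ' : 0 < (Φ z).im := hΦ
  have h2 := h.im_sub_im_inv_le hδ hB hΦ (by linarith)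
  rw [h.left_inv z hz] at h2
  have h3 : δ ^ 2 * (Φ z).im / ‖Φ z‖ ^ 2 ≤ (Φ z).im / 4 := by
    rw [div_le_div_iff₀ (pow_pos (norm_pos_of_mem_upperHalf hΦ) 2) (by norm_num)]
    have : 4 * δ ^ 2 ≤ ‖Φ z‖ ^ 2 := by nlinarith
    nlinarith
  linarith

end Small

/-! #### The normalized displacement -/

theorem im_displacement_nonneg (h : IsHullPair Φ ψ B c a) {z : ℂ} (hz : z ∈ upperHalf) :
    0 ≤ ((Φ z - z - c) / (2 * a : ℝ)).im := by
  rw [Complex.div_ofReal_im]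
  have := h.im_le hz
  have ha := h.pos
  refine div_nonneg ?_ (by positivity)
  simp only [Complex.sub_im, Complex.ofReal_im]
  linarith

theorem displacement_expansion (h : IsHullPair Φ ψ B c a) : ∃ C R : ℝ, 0 < C ∧ 1 ≤ R ∧
    ∀ z ∈ upperHalf, R < ‖z‖ → ‖z * ((Φ z - z - c) / (2 * a : ℝ)) + 1‖ ≤ C / ‖z‖ ∧
      ‖(Φ z - z - c) / (2 * a : ℝ)‖ ≤ 2 / ‖z‖ := by
  obtain ⟨C, R, hC0, hR1, hC⟩ := h.expansion'
  have ha := h.pos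
  refine ⟨C / (2 * a), max R (C / (2 * a)), by positivity, hR1.trans (le_max_left _ _),
    fun z hz hzR => ?_⟩
  have hz0 := norm_pos_of_mem_upperHalf hz
  have hz1 : z ≠ 0 := norm_pos_iff.1 hz0
  have h1 := hC z hz ((le_max_left _ _).trans_lt hzR)
  have ha' : (a : ℂ) ≠ 0 := by exact_mod_cast ha.ne'
  have e : z * ((Φ z - z - c) / (2 * a : ℝ)) + 1
      = (Φ z - z - c + 2 * a / z) * z / (2 * a : ℝ) := by
    push_cast; field_simp
  have h2 : ‖z * ((Φ z - z - c) / (2 * a : ℝ)) + 1‖ ≤ C / (2 * a) / ‖z‖ := by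
    rw [e, norm_div, norm_mul, Complex.norm_real, Real.norm_eq_abs, abs_of_pos (by positivity)]
    calc ‖Φ z - z - c + 2 * a / z‖ * ‖z‖ / (2 * a) ≤ C / ‖z‖ ^ 2 * ‖z‖ / (2 * a) := by gcongr
      _ = C / (2 * a) / ‖z‖ := by field_simp
  refine ⟨h2, ?_⟩
  have h3 : C / (2 * a) / ‖z‖ ≤ 1 := by
    rw [div_le_one hz0]; exact ((le_max_right _ _).trans_lt hzR).le
  rw [le_div_iff₀ hz0, mul_comm, ← norm_mul]
  have := norm_sub_le (z * ((Φ z - z - c) / (2 * a : ℝ)) + 1) 1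
  rw [add_sub_cancel_right, norm_one] at this
  linarith

theorem differentiableOn_displacement (h : IsHullPair Φ ψ B c a) :
    DifferentiableOn ℂ (fun z => (Φ z - z - c) / (2 * a : ℝ)) upperHalf :=
  ((h.differentiableOn.sub differentiableOn_id).sub_const _).div_const _

theorem vertical_ray_mem (x : ℝ) {Y : ℝ} (hY : 0 < Y) :
    (x + Y * Complex.I : ℂ) ∈ upperHalf ∧ Y ≤ ‖(x + Y * Complex.I : ℂ)‖ := by
  have him : (x + Y * Complex.I : ℂ).im = Y := by simp
  refine ⟨?_, ?_⟩
  · show 0 < (x + Y * Complex.I : ℂ).im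
    rw [him]; exact hY
  · have := (le_abs_self _).trans (Complex.abs_im_le_norm (x + Y * Complex.I : ℂ))
    rwa [him] at this

theorem eventually_displacement_le (h : IsHullPair Φ ψ B c a) (x : ℝ) :
    ∀ᶠ Y : ℝ in atTop, ‖(Φ (x + Y * Complex.I) - (x + Y * Complex.I) - c) / (2 * a : ℝ)‖
      ≤ 2 / Y := by
  obtain ⟨C, R, hC0, hR1, hC⟩ := h.displacement_expansion
  filter_upwards [eventually_gt_atTop R] with Y hY
  have hY0 : 0 < Y := by linarith
  obtain ⟨h1, h2⟩ := vertical_ray_mem x hY0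
  refine (hC _ h1 (by linarith)).2.trans ?_
  gcongr

theorem tendsto_displacement (h : IsHullPair Φ ψ B c a) (x : ℝ) :
    Tendsto (fun Y : ℝ => (Φ (x + Y * Complex.I) - (x + Y * Complex.I) - c) / (2 * a : ℝ))
      atTop (𝓝 0) :=
  squeeze_zero_norm' (h.eventually_displacement_le x) (tendsto_const_nhds.div_atTop tendsto_id)

theorem norm_displacement_le (h : IsHullPair Φ ψ B c a) {z : ℂ} (hz : z ∈ upperHalf) :
    ‖(Φ z - z - c) / (2 * a : ℝ)‖ ≤ 4 / z.im := by
  refine (norm_le_div_im (m := 2) (by norm_num) h.differentiableOn_displacement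
    (fun z hz => h.im_displacement_nonneg hz) h.tendsto_displacement (fun x => ?_) hz).trans
    (le_of_eq (by norm_num))
  filter_upwards [h.eventually_displacement_le x] with Y hY
  exact ((le_abs_self _).trans (Complex.abs_im_le_norm _)).trans hY

theorem norm_sub_sub_le_div_im (h : IsHullPair Φ ψ B c a) {z : ℂ} (hz : z ∈ upperHalf) :
    ‖Φ z - z - c‖ ≤ 8 * a / z.im := by
  have h1 := h.norm_displacement_le hz
  have ha := h.pos
  rw [norm_div, Complex.norm_real, Real.norm_eq_abs, abs_of_pos (by positivity),
    div_le_iff₀ (by positivity)] at h1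
  refine h1.trans (le_of_eq ?_)
  ring

section Small

variable {δ : ℝ}

/-- Heuristically the normalized displacement P is ∫ dμ(x)/(x - z) with μ a probability measure on
[-d, d], d = 6δ + |c|. Then zP + 1 = ∫ x dμ(x)/(x - z), whose imaginary part is at most d Im P in
absolute value. The maximum principle replaces the representation of P by a measure. -/
theorem im_mul_displacement_le (h : IsHullPair Φ ψ B c a) (hδ : 0 < δ)
    (hB : ∀ ζ ∈ upperHalf, δ < ‖ζ‖ → ζ ∈ B) {σ : ℝ} (hσ : |σ| = 1) {z : ℂ}
    (hz : z ∈ upperHalf) :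
    σ * (z * ((Φ z - z - c) / (2 * a : ℝ))).im ≤
      (6 * δ + |c|) * ((Φ z - z - c) / (2 * a : ℝ)).im := by
  set d := 6 * δ + |c| with hd
  have hd0 : 0 < d := by positivity
  have ha := h.pos
  set P : ℂ → ℂ := fun z => (Φ z - z - c) / (2 * a : ℝ) with hP
  set F : ℂ → ℂ := fun z => (σ : ℂ) * (z * P z) - (d : ℂ) * P z with hF
  have hFim : ∀ z, (F z).im = σ * (z * P z).im - d * (P z).im := by
    intro z; simp only [hF, Complex.sub_im, Complex.im_ofReal_mul]
  have hFim' : ∀ z, (F z).im = (σ * z.re - d) * (P z).im + σ * (z.im * (P z).re) := by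
    intro z; rw [hFim, Complex.mul_im]; ring
  have hPd := h.differentiableOn_displacement
  have key := im_nonpos_of_boundary isOpen_upperHalf (F := F)
    (((differentiableOn_id.mul hPd).const_mul _).sub (hPd.const_mul _)) ?_ ?_ z hz
  · rw [hFim] at key
    change σ * (z * P z).im ≤ d * (P z).im
    linarith
  · intro x hx η hη
    have hx0 := im_eq_zero_of_mem_frontier_upperHalf hx
    obtain ⟨R', hR'⟩ := h.norm_bounded (‖x‖ + 1)
    set Q := (|R'| + (‖x‖ + 1) + |c|) / (2 * a) with hQ
    have hPb : ∀ w ∈ upperHalf, ‖w‖ ≤ ‖x‖ + 1 → ‖P w‖ ≤ Q := by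
      intro w hw hwx
      have h1 := (hR' w hw hwx).trans (le_abs_self _)
      rw [hP]
      simp only
      rw [norm_div, Complex.norm_real, Real.norm_eq_abs, abs_of_pos (by positivity : 0 < 2 * a),
        hQ]
      gcongr
      refine (norm_sub_le _ _).trans ?_
      rw [Complex.norm_real, Real.norm_eq_abs]
      gcongr
      exact (norm_sub_le _ _).trans (by gcongr)
    set L := Q + (‖x‖ + 1) / (6 * a) with hL
    have h1 : ∀ᶠ w : ℂ in 𝓝 x, w.im * L < η := by
      refine ContinuousAt.eventually_lt (by fun_prop) continuousAt_const ?_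
      rw [hx0, zero_mul]; exact hη
    have h2 : ∀ᶠ w : ℂ in 𝓝 x, ‖w‖ < ‖x‖ + 1 :=
      ContinuousAt.eventually_lt continuous_norm.continuousAt continuousAt_const (by simp)
    filter_upwards [(h1.and h2).filter_mono nhdsWithin_le_nhds, self_mem_nhdsWithin]
      with w ⟨hw1, hw2⟩ hwU
    have hw0 : 0 < w.im := hwU
    have hPw := hPb w hwU hw2.le
    have hPn : 0 ≤ (P w).im := h.im_displacement_nonneg hwU
    have hre : σ * (w.im * (P w).re) ≤ w.im * Q := by
      refine (le_abs_self _).trans ?_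
      rw [abs_mul, hσ, one_mul, abs_mul, abs_of_pos hw0]
      gcongr
      exact (Complex.abs_re_le_norm _).trans hPw
    have hfirst : (σ * w.re - d) * (P w).im ≤ w.im * ((‖x‖ + 1) / (6 * a)) := by
      have habs : σ * w.re ≤ ‖w‖ := by
        refine (le_abs_self _).trans ?_
        rw [abs_mul, hσ, one_mul]
        exact Complex.abs_re_le_norm w
      -- If σ Re w ≤ d the factor has the right sign. Otherwise |w| > d, where Im Φ ≤ (4/3) Im w
      -- gives Im P ≤ Im w/(6a), which vanishes at the real line.
      rcases le_or_gt (σ * w.re) d with hle | hgt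
      · have h3 : (σ * w.re - d) * (P w).im ≤ 0 :=
          mul_nonpos_of_nonpos_of_nonneg (by linarith) hPn
        have h4 : 0 ≤ w.im * ((‖x‖ + 1) / (6 * a)) := by positivity
        linarith
      · have h3 := h.im_le_of_lt_norm hδ hB hwU (hgt.trans_le habs)
        have h4 : (P w).im ≤ w.im / (6 * a) := by
          simp only [hP]
          rw [Complex.div_ofReal_im, div_le_div_iff₀ (by positivity) (by positivity)]
          simp only [Complex.sub_im, Complex.ofReal_im]
          nlinarith
        calc (σ * w.re - d) * (P w).im ≤ (‖x‖ + 1) * (w.im / (6 * a)) := by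
              refine mul_le_mul ?_ h4 hPn (by positivity)
              linarith
          _ = w.im * ((‖x‖ + 1) / (6 * a)) := by ring
    rw [hFim']
    have : w.im * L = w.im * Q + w.im * ((‖x‖ + 1) / (6 * a)) := by rw [hL]; ring
    linarith
  · intro η hη
    obtain ⟨C, R, hC0, hR1, hC⟩ := h.displacement_expansion
    refine ⟨max R ((C + 2 * d) / η), fun w hw hwR => ?_⟩
    obtain ⟨h1, h2⟩ := hC w hw ((le_max_left _ _).trans_lt hwR)
    have hw0 := norm_pos_of_mem_upperHalf hw
    have h3 : (C + 2 * d) / ‖w‖ ≤ η := by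
      have h3 : (C + 2 * d) / η < ‖w‖ := (le_max_right _ _).trans_lt hwR
      rw [div_lt_iff₀ hη] at h3
      rw [div_le_iff₀ hw0]
      linarith
    have h4 : σ * (w * P w).im ≤ C / ‖w‖ := by
      refine (le_abs_self _).trans ?_
      rw [abs_mul, hσ, one_mul]
      have : (w * P w).im = (w * P w + 1).im := by simp
      rw [this]
      exact (Complex.abs_im_le_norm _).trans h1
    have h5 : -(d * (P w).im) ≤ d * (2 / ‖w‖) := by
      have h6 := (neg_le_abs _).trans ((Complex.abs_im_le_norm (P w)).trans h2)
      nlinarith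
    rw [hFim]
    have h6 : (C + 2 * d) / ‖w‖ = C / ‖w‖ + d * (2 / ‖w‖) := by ring
    linarith

/-- Adding dP to zP + 1 makes the imaginary part nonnegative (sign σ = -1 of the previous bound),
while σ = 1 bounds it by 2d Im P ≤ 4d/Y on vertical rays. So `norm_le_div_im` applies with m = 4d,
and dP is then subtracted again. -/
theorem norm_mul_displacement_add_one_le (h : IsHullPair Φ ψ B c a) (hδ : 0 < δ)
    (hB : ∀ ζ ∈ upperHalf, δ < ‖ζ‖ → ζ ∈ B) {z : ℂ} (hz : z ∈ upperHalf) :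
    ‖z * ((Φ z - z - c) / (2 * a : ℝ)) + 1‖ ≤ 12 * (6 * δ + |c|) / z.im := by
  have hz' : 0 < z.im := hz
  set d := 6 * δ + |c| with hd
  have hd0 : 0 < d := by positivity
  set P : ℂ → ℂ := fun z => (Φ z - z - c) / (2 * a : ℝ) with hP
  have hPd := h.differentiableOn_displacement
  set E : ℂ → ℂ := fun z => z * P z + 1 + (d : ℂ) * P z with hE
  have hEim : ∀ z, (E z).im = (z * P z).im + d * (P z).im := by
    intro z; simp only [hE, Complex.add_im, Complex.im_ofReal_mul, Complex.one_im, add_zero]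
  have hE1 := norm_le_div_im (F := E) (m := 4 * d) (by positivity)
    (((differentiableOn_id.mul hPd).add_const _).add (hPd.const_mul _)) ?_ ?_ ?_ hz
  · have h2 : ‖(d : ℂ) * P z‖ ≤ d * (4 / z.im) := by
      rw [norm_mul, Complex.norm_real, Real.norm_eq_abs, abs_of_pos hd0]
      gcongr
      exact h.norm_displacement_le hz
    calc ‖z * P z + 1‖ = ‖E z - (d : ℂ) * P z‖ := by simp only [hE]; ring_nf
      _ ≤ 2 * (4 * d) / z.im + d * (4 / z.im) := (norm_sub_le _ _).trans (by linarith)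
      _ = 12 * d / z.im := by ring
  · intro w hw
    have := h.im_mul_displacement_le hδ hB (σ := -1) (by simp) hw
    rw [hEim]
    change -1 * (w * P w).im ≤ d * (P w).im at this
    linarith
  · intro x
    obtain ⟨C, R, hC0, hR1, hC⟩ := h.displacement_expansion
    have h1 : Tendsto (fun Y : ℝ => (x + Y * Complex.I : ℂ) * P (x + Y * Complex.I) + 1) atTop
        (𝓝 0) := by
      refine squeeze_zero_norm' (a := fun Y : ℝ => C / Y) ?_
        (tendsto_const_nhds.div_atTop tendsto_id)
      filter_upwards [eventually_gt_atTop R] with Y hY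
      have hY0 : 0 < Y := by linarith
      obtain ⟨h1, h2⟩ := vertical_ray_mem x hY0
      refine (hC _ h1 (by linarith)).1.trans ?_
      gcongr
    have h2 := h1.add ((h.tendsto_displacement x).const_mul (d : ℂ))
    rw [mul_zero, add_zero] at h2
    exact h2
  · intro x
    filter_upwards [h.eventually_displacement_le x, eventually_gt_atTop 0] with Y hY hY0
    have h1 := h.im_mul_displacement_le hδ hB (σ := 1) (by simp) (vertical_ray_mem x hY0).1
    have h2 := ((le_abs_self _).trans (Complex.abs_im_le_norm _)).trans hY
    change 1 * ((x + Y * Complex.I : ℂ) * P (x + Y * Complex.I)).im ≤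
      d * (P (x + Y * Complex.I)).im at h1
    change (P (x + Y * Complex.I)).im ≤ 2 / Y at h2
    rw [hEim]
    have h3 : 4 * d / Y = 2 * (d * (2 / Y)) := by ring
    nlinarith

/-- If the hull is small then the displacement is close to `-2 a / z`. -/
theorem norm_sub_sub_add_le (h : IsHullPair Φ ψ B c a) (hδ : 0 < δ)
    (hB : ∀ ζ ∈ upperHalf, δ < ‖ζ‖ → ζ ∈ B) {z : ℂ} (hz : z ∈ upperHalf) :
    ‖Φ z - z - c + 2 * a / z‖ ≤ 24 * a * (6 * δ + |c|) / z.im ^ 2 := by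
  have hz' : 0 < z.im := hz
  have ha := h.pos
  have hz0 := norm_pos_of_mem_upperHalf hz
  have hz1 : z ≠ 0 := norm_pos_iff.1 hz0
  have ha' : (a : ℂ) ≠ 0 := by exact_mod_cast ha.ne'
  have h1 := h.norm_mul_displacement_add_one_le hδ hB hz
  have e : Φ z - z - c + 2 * a / z
      = (2 * a : ℝ) / z * (z * ((Φ z - z - c) / (2 * a : ℝ)) + 1) := by
    push_cast; field_simp
  rw [e, norm_mul, norm_div, Complex.norm_real, Real.norm_eq_abs,
    abs_of_pos (by positivity : 0 < 2 * a)]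
  calc 2 * a / ‖z‖ * ‖z * ((Φ z - z - c) / (2 * a : ℝ)) + 1‖
      ≤ 2 * a / z.im * (12 * (6 * δ + |c|) / z.im) := by
        gcongr
        exact (le_abs_self _).trans (Complex.abs_im_le_norm z)
    _ = 24 * a * (6 * δ + |c|) / z.im ^ 2 := by field_simp; ring

end Small

end IsHullPair

/-! ### Slit chains in the plane and their transition maps -/

/-- The complement of `c (-∞, t]` in the plane. -/
def slitCompl (c : ℝ → ℂ) (t : ℝ) : Set ℂ := {u | ∀ r ≤ t, c r ≠ u}

/-- A chordal chain in the plane: `F t` are conformal maps of the complement of `c (-∞, t]` onto the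
upper half-plane, and `f t` is `F t ∘ (F 0)⁻¹`, with capacity expansion at infinity. -/
structure IsSlitChain (c : ℝ → ℂ) (F f : ℝ → ℂ → ℂ) (lam : ℝ → ℝ) : Prop where
  continuous : Continuous c
  injective : Function.Injective c
  isOpen : ∀ t, IsOpen (slitCompl c t)
  differentiableOn : ∀ t, DifferentiableOn ℂ (F t) (slitCompl c t)
  bijOn : ∀ t, BijOn (F t) (slitCompl c t) upperHalf
  tip : ∀ t, Tendsto (F t) (𝓝[slitCompl c t] (c t)) (𝓝 0)
  conj : ∀ t, ∀ u ∈ slitCompl c 0, f t (F 0 u) = F t u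
  expansion : ∀ t, HasExpansion (f t) (lam t) t

theorem HasExpansion.exists_bound {f : ℂ → ℂ} {l a : ℝ} (h : HasExpansion f l a) :
    ∃ C R : ℝ, 0 < C ∧ 1 ≤ R ∧ ∀ z ∈ upperHalf, R < ‖z‖ →
      ‖f z - (z - l + 2 * a / z)‖ ≤ C / ‖z‖ ^ 2 := by
  obtain ⟨C, hC0, hC⟩ := IsBigO.exists_pos h
  rw [isBigOWith_iff, eventually_inf_principal, ← Metric.cobounded_eq_cocompact,
    ← comap_norm_atTop, eventually_comap] at hC
  obtain ⟨R, hR⟩ := eventually_atTop.1 hC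
  refine ⟨C, max R 1, hC0, le_max_right _ _, fun z hz hzR => ?_⟩
  have := hR ‖z‖ ((le_max_left _ _).trans hzR.le) z rfl hz
  refine this.trans (le_of_eq ?_)
  rw [norm_div, norm_pow, norm_one]
  ring

/-- The inverse of `F t`. -/
noncomputable def slitInv (c : ℝ → ℂ) (F : ℝ → ℂ → ℂ) (t : ℝ) : ℂ → ℂ :=
  Function.invFunOn (F t) (slitCompl c t)

namespace IsSlitChain

variable {c : ℝ → ℂ} {F f : ℝ → ℂ → ℂ} {lam : ℝ → ℝ}

theorem slitCompl_antitone {s t : ℝ} (hst : s ≤ t) : slitCompl c t ⊆ slitCompl c s :=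
  fun _ hu r hr => hu r (hr.trans hst)

theorem exists_of_notMem {s t : ℝ} {u : ℂ} (hs : u ∈ slitCompl c s) (ht : u ∉ slitCompl c t) :
    ∃ r ∈ Ioc s t, c r = u := by
  simp only [slitCompl, mem_ofPred_eq, not_forall, not_not] at ht
  obtain ⟨r, hr, hru⟩ := ht
  refine ⟨r, ⟨?_, hr⟩, hru⟩
  by_contra! h
  exact hs r h hru

theorem curve_mem (h : IsSlitChain c F f lam) {s r : ℝ} (hsr : s < r) : c r ∈ slitCompl c s := by
  intro q hq heq
  have := h.injective heq
  linarith

theorem slitInv_mem (h : IsSlitChain c F f lam) (t : ℝ) {z : ℂ} (hz : z ∈ upperHalf) :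
    slitInv c F t z ∈ slitCompl c t :=
  (h.bijOn t).surjOn.mapsTo_invFunOn hz

theorem apply_slitInv (h : IsSlitChain c F f lam) (t : ℝ) {z : ℂ} (hz : z ∈ upperHalf) :
    F t (slitInv c F t z) = z :=
  (h.bijOn t).surjOn.rightInvOn_invFunOn hz

theorem slitInv_apply (h : IsSlitChain c F f lam) (t : ℝ) {u : ℂ} (hu : u ∈ slitCompl c t) :
    slitInv c F t (F t u) = u :=
  (h.bijOn t).injOn.leftInvOn_invFunOn hu

theorem mapsTo (h : IsSlitChain c F f lam) (t : ℝ) {u : ℂ} (hu : u ∈ slitCompl c t) :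
    F t u ∈ upperHalf := (h.bijOn t).mapsTo hu

theorem differentiableOn_slitInv (h : IsSlitChain c F f lam) (t : ℝ) :
    DifferentiableOn ℂ (slitInv c F t) upperHalf := by
  intro z hz
  have h1 := differentiableAt_leftInverse (h.isOpen t) (h.differentiableOn t) (h.bijOn t).injOn
    (fun v hv => h.slitInv_apply t hv) (h.slitInv_mem t hz)
  rw [h.apply_slitInv t hz] at h1
  exact h1.differentiableWithinAt

theorem tendsto_tip (h : IsSlitChain c F f lam) (s : ℝ) :
    Tendsto (fun r => F s (c r)) (𝓝[>] s) (𝓝 0) := by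
  refine (h.tip s).comp (tendsto_nhdsWithin_iff.2 ⟨?_, ?_⟩)
  · exact h.continuous.continuousAt.tendsto.mono_left nhdsWithin_le_nhds
  · filter_upwards [self_mem_nhdsWithin] with r hr using h.curve_mem hr

theorem eventually_hull_small (h : IsSlitChain c F f lam) (s : ℝ) {δ : ℝ} (hδ : 0 < δ) :
    ∀ᶠ t in 𝓝[>] s, ∀ r ∈ Ioc s t, ‖F s (c r)‖ < δ := by
  have h1 : ∀ᶠ r in 𝓝[>] s, ‖F s (c r)‖ < δ := by
    have := (h.tendsto_tip s).norm
    rw [norm_zero] at this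
    exact this.eventually_lt_const hδ
  obtain ⟨b, hb, hsub⟩ := mem_nhdsGT_iff_exists_Ioo_subset.1 h1
  filter_upwards [Ioo_mem_nhdsGT hb] with t ht r hr
  exact hsub ⟨hr.1, hr.2.trans_lt ht.2⟩

/-- The point c(s) is outside the domain of F_s, so compactness is available only on [b, t] with b >
s; the tip condition covers (s, b]. -/
theorem hull_bounded (h : IsSlitChain c F f lam) (s t : ℝ) :
    ∃ R : ℝ, ∀ r ∈ Ioc s t, ‖F s (c r)‖ ≤ R := by
  obtain ⟨b, hb, hsub⟩ := (((h.eventually_hull_small s one_pos).and self_mem_nhdsWithin).exists)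
  have hsub' : s < b := hsub
  have hK : IsCompact ((fun r => F s (c r)) '' Icc b t) := by
    refine isCompact_Icc.image_of_continuousOn ?_
    refine (h.differentiableOn s).continuousOn.comp h.continuous.continuousOn fun r hr => ?_
    exact h.curve_mem (hsub'.trans_le hr.1)
  obtain ⟨R, hR⟩ := hK.isBounded.exists_norm_le
  refine ⟨max 1 R, fun r hr => ?_⟩
  rcases le_or_gt r b with hrb | hrb
  · exact (hb r ⟨hr.1, hrb⟩).le.trans (le_max_left _ _)
  · exact (hR _ ⟨r, ⟨hrb.le, hr.2⟩, rfl⟩).trans (le_max_right _ _)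

theorem slitInv_mem_of_lt (h : IsSlitChain c F f lam) (s t : ℝ) :
    ∃ R : ℝ, ∀ z ∈ upperHalf, R < ‖z‖ → slitInv c F s z ∈ slitCompl c t := by
  obtain ⟨R, hR⟩ := h.hull_bounded s t
  refine ⟨R, fun z hz hzR => ?_⟩
  by_contra hn
  obtain ⟨r, hr, hru⟩ := exists_of_notMem (h.slitInv_mem s hz) hn
  have := hR r hr
  rw [hru, h.apply_slitInv s hz] at this
  linarith

/-- The expansions are given in the time-0 coordinate, so using them at time t requires F_0 ∘ F_t⁻¹
to be proper at infinity. As f_t moves far points by at most D, the modulus R₁ can be taken only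
when |z| ≤ R₁ + D; connectedness does the rest. -/
theorem lt_norm_zero_slitInv (h : IsSlitChain c F f lam) (t R : ℝ) :
    ∃ R' : ℝ, ∀ z ∈ upperHalf, R' < ‖z‖ →
      slitInv c F t z ∈ slitCompl c 0 ∧ R < ‖F 0 (slitInv c F t z)‖ := by
  obtain ⟨C, R₀, hC0, hR1, hC⟩ := (h.expansion t).exists_bound
  obtain ⟨RA, hRA⟩ := h.slitInv_mem_of_lt t 0
  obtain ⟨RB, hRB⟩ := h.slitInv_mem_of_lt 0 t
  set D := |lam t| + 2 * |t| + C with hD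
  have hD0 : 0 ≤ D := by positivity
  have hbd : ∀ Z ∈ upperHalf, R₀ < ‖Z‖ → ‖f t Z - Z‖ ≤ D := by
    intro Z hZ hZR
    have hZ1 : 1 ≤ ‖Z‖ := by linarith
    have h1 := hC Z hZ hZR
    have h2 : C / ‖Z‖ ^ 2 ≤ C := div_le_self hC0.le (one_le_pow₀ hZ1)
    have h3 : ‖(2 * t / Z : ℂ)‖ ≤ 2 * |t| := by
      rw [norm_div, norm_mul, Complex.norm_real, Real.norm_eq_abs, Complex.norm_ofNat]
      exact div_le_self (by positivity) hZ1
    calc ‖f t Z - Z‖ = ‖(f t Z - (Z - lam t + 2 * t / Z)) - lam t + 2 * t / Z‖ := by ring_nf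
      _ ≤ ‖f t Z - (Z - lam t + 2 * t / Z)‖ + ‖(lam t : ℂ)‖ + ‖(2 * t / Z : ℂ)‖ :=
        (norm_add_le _ _).trans (by gcongr; exact norm_sub_le _ _)
      _ ≤ D := by rw [Complex.norm_real, Real.norm_eq_abs]; linarith
  set R₁ := max R (R₀ + 1)
  have hR₁ : R₀ < R₁ := by linarith [le_max_right R (R₀ + 1)]
  set R' := max (R₁ + D) RA
  have hA : ∀ z ∈ upperHalf, R' < ‖z‖ → slitInv c F t z ∈ slitCompl c 0 := fun z hz hzR =>
    hRA z hz ((le_max_right _ _).trans_lt hzR)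
  refine ⟨R', fun z hz hzR => ⟨hA z hz hzR, (le_max_left R (R₀ + 1)).trans_lt ?_⟩⟩
  obtain ⟨Y, hY1, hY2, hY3, hY4⟩ : ∃ Y : ℝ, R₁ < Y ∧ R' + D < Y ∧ 0 < Y ∧ RB < Y :=
    ((eventually_gt_atTop R₁).and ((eventually_gt_atTop _).and ((eventually_gt_atTop 0).and
      (eventually_gt_atTop RB)))).exists
  obtain ⟨hYm, hYn⟩ := norm_ofReal_mul_I_mem hY3
  set u₀ := slitInv c F 0 (Y * Complex.I) with hu₀
  have hu₀0 : u₀ ∈ slitCompl c 0 := h.slitInv_mem 0 hYm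
  have hu₀t : u₀ ∈ slitCompl c t := hRB _ hYm (by rw [hYn]; exact hY4)
  have hFu₀ : F 0 u₀ = Y * Complex.I := h.apply_slitInv 0 hYm
  have hfY : f t (Y * Complex.I) = F t u₀ := by rw [← hFu₀]; exact h.conj t u₀ hu₀0
  refine lt_norm_of_norm_ne (g := fun z => F 0 (slitInv c F t z)) (R := R') (R₁ := R₁)
    (z₀ := F t u₀) ?_ ?_ (h.mapsTo t hu₀t) ?_ ?_ hz hzR
  · refine (h.differentiableOn 0).continuousOn.comp
      ((h.differentiableOn_slitInv t).continuousOn.mono fun w hw => hw.1) fun w hw => ?_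
    exact hA w hw.1 hw.2
  · intro w hw hwR hn
    have hw0 := hA w hw hwR
    have h1 := hbd (F 0 (slitInv c F t w)) (h.mapsTo 0 hw0) (by rw [hn]; exact hR₁)
    rw [h.conj t _ hw0, h.apply_slitInv t hw] at h1
    have h2 := norm_le_norm_add_norm_sub' w (F 0 (slitInv c F t w))
    have h3 := le_max_left (R₁ + D) RA
    rw [hn] at h2
    change R' < _ at hwR
    linarith
  · have h1 := hbd _ hYm (by rw [hYn]; linarith)
    rw [hfY] at h1
    have h2 := norm_le_norm_add_norm_sub (F t u₀) (Y * Complex.I)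
    rw [hYn] at h2
    linarith
  · show R₁ < ‖F 0 (slitInv c F t (F t u₀))‖
    rw [h.slitInv_apply t hu₀t, hFu₀, hYn]; exact hY1

/-- Subtract the expansions of f_t and f_s at the common point Z = F_0(F_t⁻¹ z). Since z - Z is
bounded and |z| ≤ 2|Z|, replacing Z by z in the 1/Z term costs only O(1/|z|²). -/
theorem transition_expansion (h : IsSlitChain c F f lam) {s t : ℝ} (hst : s < t) :
    ∃ C R : ℝ, ∀ z ∈ upperHalf, R < ‖z‖ →
      ‖F s (slitInv c F t z) - (z + (lam t - lam s : ℝ) - 2 * (t - s : ℝ) / z)‖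
        ≤ C / ‖z‖ ^ 2 := by
  obtain ⟨C₁, R₁, hC10, hR11, hC₁⟩ := (h.expansion t).exists_bound
  obtain ⟨C₂, R₂, hC20, hR21, hC₂⟩ := (h.expansion s).exists_bound
  set D := |lam t| + 2 * |t| + C₁ with hD
  have hD0 : 0 ≤ D := by positivity
  obtain ⟨R', hR'⟩ := h.lt_norm_zero_slitInv t (max (max R₁ R₂) D)
  refine ⟨(C₁ + C₂) * 4 + 2 * (t - s) * D * 2, R', fun z hz hzR => ?_⟩
  obtain ⟨h0, hlt⟩ := hR' z hz hzR
  set Z := F 0 (slitInv c F t z) with hZdef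
  have hZ : Z ∈ upperHalf := h.mapsTo 0 h0
  have hZ0 := norm_pos_of_mem_upperHalf hZ
  have hz0 := norm_pos_of_mem_upperHalf hz
  have hlt1 : R₁ < ‖Z‖ := ((le_max_left _ _).trans (le_max_left _ _)).trans_lt hlt
  have hlt2 : R₂ < ‖Z‖ := ((le_max_right _ _).trans (le_max_left _ _)).trans_lt hlt
  have hlt3 : D < ‖Z‖ := (le_max_right _ _).trans_lt hlt
  have e1 := hC₁ Z hZ hlt1
  have e2 := hC₂ Z hZ hlt2
  rw [hZdef, h.conj t _ h0, h.apply_slitInv t hz, ← hZdef] at e1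
  rw [hZdef, h.conj s _ h0, ← hZdef] at e2
  have hZ1 : 1 ≤ ‖Z‖ := by linarith
  have hzZ : ‖z - Z‖ ≤ D := by
    have h2 : C₁ / ‖Z‖ ^ 2 ≤ C₁ := div_le_self hC10.le (one_le_pow₀ hZ1)
    have h3 : ‖(2 * t / Z : ℂ)‖ ≤ 2 * |t| := by
      rw [norm_div, norm_mul, Complex.norm_real, Real.norm_eq_abs, Complex.norm_ofNat]
      exact div_le_self (by positivity) hZ1
    calc ‖z - Z‖ = ‖(z - (Z - lam t + 2 * t / Z)) - lam t + 2 * t / Z‖ := by ring_nf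
      _ ≤ ‖z - (Z - lam t + 2 * t / Z)‖ + ‖(lam t : ℂ)‖ + ‖(2 * t / Z : ℂ)‖ :=
        (norm_add_le _ _).trans (by gcongr; exact norm_sub_le _ _)
      _ ≤ D := by rw [Complex.norm_real, Real.norm_eq_abs]; linarith
  have hz2 : ‖z‖ ≤ 2 * ‖Z‖ := by
    have := norm_le_norm_add_norm_sub' z Z
    linarith
  have hinv : 1 / ‖Z‖ ≤ 2 / ‖z‖ := by
    rw [div_le_div_iff₀ hZ0 hz0]; linarith
  have hzne : z ≠ 0 := norm_pos_iff.1 hz0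
  have hZne : Z ≠ 0 := norm_pos_iff.1 hZ0
  have hdiff : ‖(2 * (t - s : ℝ) / z - 2 * (t - s : ℝ) / Z : ℂ)‖
      ≤ 2 * (t - s) * D * 2 / ‖z‖ ^ 2 := by
    have e : (2 * (t - s : ℝ) / z - 2 * (t - s : ℝ) / Z : ℂ)
        = (2 * (t - s) : ℝ) * (Z - z) / (z * Z) := by
      push_cast; field_simp
    rw [e, norm_div, norm_mul, norm_mul, Complex.norm_real, Real.norm_eq_abs,
      abs_of_pos (by linarith), norm_sub_rev]
    calc 2 * (t - s) * ‖z - Z‖ / (‖z‖ * ‖Z‖)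
        = 2 * (t - s) * ‖z - Z‖ / ‖z‖ * (1 / ‖Z‖) := by field_simp
      _ ≤ 2 * (t - s) * D / ‖z‖ * (2 / ‖z‖) := by
          have : 0 ≤ t - s := by linarith
          gcongr
      _ = 2 * (t - s) * D * 2 / ‖z‖ ^ 2 := by field_simp
  have hsq : (C₁ + C₂) / ‖Z‖ ^ 2 ≤ (C₁ + C₂) * 4 / ‖z‖ ^ 2 := by
    rw [div_le_div_iff₀ (by positivity) (by positivity), mul_assoc]
    refine mul_le_mul_of_nonneg_left ?_ (by positivity)
    nlinarith
  calc ‖F s (slitInv c F t z) - (z + (lam t - lam s : ℝ) - 2 * (t - s : ℝ) / z)‖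
      = ‖(F s (slitInv c F t z) - (Z - lam s + 2 * s / Z)) - (z - (Z - lam t + 2 * t / Z))
          + (2 * (t - s : ℝ) / z - 2 * (t - s : ℝ) / Z)‖ := by
        congr 1; push_cast; ring
    _ ≤ C₂ / ‖Z‖ ^ 2 + C₁ / ‖Z‖ ^ 2 + 2 * (t - s) * D * 2 / ‖z‖ ^ 2 :=
        (norm_add_le _ _).trans (add_le_add ((norm_sub_le _ _).trans (add_le_add e2 e1)) hdiff)
    _ = (C₁ + C₂) / ‖Z‖ ^ 2 + 2 * (t - s) * D * 2 / ‖z‖ ^ 2 := by ring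
    _ ≤ (C₁ + C₂) * 4 / ‖z‖ ^ 2 + 2 * (t - s) * D * 2 / ‖z‖ ^ 2 := by gcongr
    _ = ((C₁ + C₂) * 4 + 2 * (t - s) * D * 2) / ‖z‖ ^ 2 := by ring

theorem isHullPair (h : IsSlitChain c F f lam) {s t : ℝ} (hst : s < t) :
    IsHullPair (fun z => F s (slitInv c F t z)) (fun z => F t (slitInv c F s z))
      {z | z ∈ upperHalf ∧ slitInv c F s z ∈ slitCompl c t} (lam t - lam s) (t - s) where
  subset := fun z hz => hz.1
  differentiableOn := (h.differentiableOn s).comp (h.differentiableOn_slitInv t)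
    fun z hz => slitCompl_antitone hst.le (h.slitInv_mem t hz)
  differentiableOn_inv := (h.differentiableOn t).comp
    ((h.differentiableOn_slitInv s).mono fun z hz => hz.1) fun z hz => hz.2
  mapsTo := fun z hz => by
    have hm := h.slitInv_mem t hz
    have hm' := slitCompl_antitone hst.le hm
    refine ⟨h.mapsTo s hm', ?_⟩
    rw [h.slitInv_apply s hm']
    exact hm
  mapsTo_inv := fun z hz => h.mapsTo t hz.2
  left_inv := fun z hz => by
    show F t (slitInv c F s (F s (slitInv c F t z))) = z
    rw [h.slitInv_apply s (slitCompl_antitone hst.le (h.slitInv_mem t hz)), h.apply_slitInv t hz]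
  right_inv := fun z hz => by
    show F s (slitInv c F t (F t (slitInv c F s z))) = z
    rw [h.slitInv_apply t hz.2, h.apply_slitInv s hz.1]
  pos := by linarith
  mem_of_lt := by
    obtain ⟨R, hR⟩ := h.slitInv_mem_of_lt s t
    exact ⟨R, fun z hz hzR => ⟨hz, hR z hz hzR⟩⟩
  expansion := h.transition_expansion hst

/-! ### The Loewner equation at points never swallowed -/

section Flow

variable {w : ℂ}

theorem eventually_hull_subset (h : IsSlitChain c F f lam) (s : ℝ) {δ : ℝ} (hδ : 0 < δ) :
    ∀ᶠ t in 𝓝[>] s, ∀ z ∈ upperHalf, δ < ‖z‖ →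
      z ∈ {z | z ∈ upperHalf ∧ slitInv c F s z ∈ slitCompl c t} := by
  filter_upwards [h.eventually_hull_small s hδ] with t ht z hz hzδ
  refine ⟨hz, ?_⟩
  by_contra hn
  obtain ⟨r, hr, hru⟩ := exists_of_notMem (h.slitInv_mem s hz) hn
  have := ht r hr
  rw [hru, h.apply_slitInv s hz] at this
  linarith

/-- As s ↑ t the transition map is evaluated at the fixed point F_t w, so the bound 8(t - s)/Im F_t
w suffices and the hull need not be small. -/
theorem continuousWithinAt_flow_left (h : IsSlitChain c F f lam) (hw : ∀ t, w ∈ slitCompl c t)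
    (t : ℝ) : ContinuousWithinAt (fun s => F s w + lam s) (Iio t) t := by
  rw [ContinuousWithinAt, tendsto_iff_norm_sub_tendsto_zero]
  have hpos : 0 < (F t w).im := h.mapsTo t (hw t)
  refine squeeze_zero' (g := fun s => 8 * (t - s) / (F t w).im)
    (Eventually.of_forall fun _ => norm_nonneg _) ?_ ?_
  · filter_upwards [self_mem_nhdsWithin] with s hs
    have h1 := (h.isHullPair hs).norm_sub_sub_le_div_im (h.mapsTo t (hw t))
    rw [h.slitInv_apply t (hw t)] at h1
    refine le_trans (le_of_eq ?_) h1
    congr 1; push_cast; ring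
  · have : Tendsto (fun s : ℝ => 8 * (t - s) / (F t w).im) (𝓝 t) (𝓝 (8 * (t - t) / (F t w).im)) :=
      Continuous.tendsto (by fun_prop) t
    rw [sub_self, mul_zero, zero_div] at this
    exact this.mono_left nhdsWithin_le_nhds

/-- As t ↓ s there is no lower bound yet for Im F_t w. The inverse transition map is used instead,
at the fixed point F_s w, with a hull of radius δ → 0. -/
theorem continuousWithinAt_flow_right (h : IsSlitChain c F f lam) (hw : ∀ t, w ∈ slitCompl c t)
    (s : ℝ) : ContinuousWithinAt (fun t => F t w + lam t) (Ioi s) s := by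
  rw [ContinuousWithinAt, Metric.tendsto_nhds]
  intro η hη
  have hm := h.mapsTo s (hw s)
  have hn := norm_pos_of_mem_upperHalf hm
  obtain ⟨δ, hδ1, hδ2, hδ0⟩ : ∃ δ : ℝ, 8 * δ ^ 2 / ‖F s w‖ < η ∧ 2 * δ < ‖F s w‖ ∧ 0 < δ := by
    have h1 : ∀ᶠ δ : ℝ in 𝓝 0, 8 * δ ^ 2 / ‖F s w‖ < η :=
      ContinuousAt.eventually_lt (by fun_prop) continuousAt_const (by simpa using hη)
    have h2 : ∀ᶠ δ : ℝ in 𝓝 0, 2 * δ < ‖F s w‖ :=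
      ContinuousAt.eventually_lt (by fun_prop) continuousAt_const (by simpa using hn)
    exact (((h1.filter_mono nhdsWithin_le_nhds).and ((h2.filter_mono nhdsWithin_le_nhds).and
      (self_mem_nhdsWithin (s := Ioi (0 : ℝ))))).exists)
  filter_upwards [h.eventually_hull_subset s hδ0, self_mem_nhdsWithin] with t ht hst
  have h1 := (h.isHullPair hst).norm_sub_inv_sub_le hδ0 ht hm hδ2.le
  rw [h.slitInv_apply s (hw s)] at h1
  rw [dist_comm, dist_eq_norm]
  refine lt_of_le_of_lt (le_of_eq ?_) (h1.trans_lt hδ1)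
  congr 1; push_cast; ring

theorem continuous_flow (h : IsSlitChain c F f lam) (hlam : Continuous lam)
    (hw : ∀ t, w ∈ slitCompl c t) : Continuous fun t => F t w := by
  have h1 : Continuous fun t => F t w + lam t := by
    rw [continuous_iff_continuousAt]
    intro t
    rw [continuousAt_iff_continuous_left'_right']
    exact ⟨h.continuousWithinAt_flow_left hw t, h.continuousWithinAt_flow_right hw t⟩
  have h2 : Continuous fun t => (F t w + lam t) - (lam t : ℂ) :=
    h1.sub (Complex.continuous_ofReal.comp hlam)
  simpa using h2

/-- The displacement is -2(t - s)/F_t w with error (t - s) · O(δ + |λ_t - λ_s|), and continuity of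
the flow replaces F_t w by F_s w in the limit. Smallness of the hull is known for fixed s and t ↓ s,
hence only a right derivative here. -/
theorem hasDerivWithinAt_flow (h : IsSlitChain c F f lam) (hlam : Continuous lam)
    (hw : ∀ t, w ∈ slitCompl c t) (s : ℝ) :
    HasDerivWithinAt (fun t => F t w + lam t) (2 / F s w) (Ioi s) s := by
  rw [hasDerivWithinAt_iff_tendsto_slope' (notMem_Ioi.2 le_rfl)]
  have hm := h.mapsTo s (hw s)
  have hs0 : F s w ≠ 0 := norm_pos_iff.1 (norm_pos_of_mem_upperHalf hm)
  have him : 0 < (F s w).im := hm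
  have hc := h.continuous_flow hlam hw
  have hlim : Tendsto (fun t => 2 / F t w) (𝓝[>] s) (𝓝 (2 / F s w)) :=
    ((continuousAt_const.div hc.continuousAt hs0).tendsto).mono_left nhdsWithin_le_nhds
  suffices hz : Tendsto (fun t => slope (fun t => F t w + lam t) s t - 2 / F t w) (𝓝[>] s)
      (𝓝 0) by simpa using hz.add hlim
  rw [Metric.tendsto_nhds]
  intro η hη
  set κ := 24 / ((F s w).im / 2) ^ 2 with hκ
  have hκ0 : 0 < κ := by positivity
  -- The error per unit time is at most κ(6δ + δ) = 7κδ, which is η/2.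
  set δ := η / (κ * 14) with hδ
  have hδ0 : 0 < δ := by positivity
  have hl : ∀ᶠ t in 𝓝 s, |lam t - lam s| < δ := by
    have := (Metric.continuous_iff'.1 hlam) s δ hδ0
    simpa [Real.dist_eq] using this
  have hi : ∀ᶠ t in 𝓝 s, (F s w).im / 2 < (F t w).im :=
    continuousAt_const.eventually_lt (Complex.continuous_im.comp hc).continuousAt
      (by change _ < (F s w).im; linarith)
  filter_upwards [h.eventually_hull_subset s hδ0, self_mem_nhdsWithin,
    hl.filter_mono nhdsWithin_le_nhds, hi.filter_mono nhdsWithin_le_nhds] with t ht hst hlt hit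
  have hst' : s < t := hst
  have hts : 0 < t - s := by linarith
  have hmt := h.mapsTo t (hw t)
  have h1 := (h.isHullPair hst).norm_sub_sub_add_le hδ0 ht hmt
  rw [h.slitInv_apply t (hw t)] at h1
  have htne : F t w ≠ 0 := norm_pos_iff.1 (norm_pos_of_mem_upperHalf hmt)
  have htsne : ((t - s : ℝ) : ℂ) ≠ 0 := by exact_mod_cast hts.ne'
  have e : slope (fun t => F t w + (lam t : ℂ)) s t - 2 / F t w
      = -(F s w - F t w - (lam t - lam s : ℝ) + 2 * (t - s : ℝ) / F t w) / (t - s : ℝ) := by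
    rw [slope_def_module, Complex.real_smul, Complex.ofReal_inv]
    field_simp
    push_cast
    ring
  rw [dist_zero_right, e, norm_div, norm_neg, Complex.norm_real, Real.norm_eq_abs,
    abs_of_pos hts, div_lt_iff₀ hts]
  refine h1.trans_lt ?_
  have h2 : 24 * (t - s) * (6 * δ + |lam t - lam s|) / (F t w).im ^ 2
      ≤ 24 * (t - s) * (6 * δ + δ) / ((F s w).im / 2) ^ 2 := by gcongr
  refine h2.trans_lt ?_
  have h3 : 24 * (t - s) * (6 * δ + δ) / ((F s w).im / 2) ^ 2 = (t - s) * (κ * 7 * δ) := by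
    rw [hκ]; ring
  have h4 : κ * 7 * δ = η / 2 := by rw [hδ]; field_simp; norm_num
  rw [h3, h4]
  nlinarith

end Flow

end IsSlitChain

/-- A continuous function with continuous right derivative is differentiable. -/
theorem hasDerivAt_of_hasDerivWithinAt_Ioi {g k : ℝ → ℂ} (hg : Continuous g) (hk : Continuous k)
    (hd : ∀ s, HasDerivWithinAt g (k s) (Ioi s) s) (t : ℝ) : HasDerivAt g (k t) t := by
  have hI : ∀ s, HasDerivAt (fun x => ∫ r in (0 : ℝ)..x, k r) (k s) s := fun s =>
    intervalIntegral.integral_hasDerivAt_right (hk.intervalIntegrable _ _)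
      (hk.stronglyMeasurableAtFilter _ _) hk.continuousAt
  -- Subtracting a primitive of `k` leaves a continuous function with vanishing right derivative,
  -- hence a constant.
  have hcont : Continuous fun s => g s - ∫ r in (0 : ℝ)..s, k r :=
    hg.sub (continuous_iff_continuousAt.2 fun s => (hI s).continuousAt)
  have hconst : ∀ x ∈ Icc (t - 1) (t + 1), g x - ∫ r in (0 : ℝ)..x, k r =
      g (t - 1) - ∫ r in (0 : ℝ)..(t - 1), k r :=
    constant_of_has_deriv_right_zero (f := fun s => g s - ∫ r in (0 : ℝ)..s, k r)
      hcont.continuousOn fun s _ => by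
        have h1 := ((hd s).Ici_of_Ioi).sub (hI s).hasDerivWithinAt
        rwa [sub_self] at h1
  have h2 : HasDerivAt (fun x => (g (t - 1) - ∫ r in (0 : ℝ)..(t - 1), k r)
      + ∫ r in (0 : ℝ)..x, k r) (k t) t := (hI t).const_add _
  refine h2.congr_of_eventuallyEq ?_
  filter_upwards [Icc_mem_nhds (by linarith : t - 1 < t) (by linarith : t < t + 1)] with x hx
  rw [← hconst x hx]
  ring

/-- The Loewner equation. -/
theorem IsSlitChain.hasDerivAt_flow {c : ℝ → ℂ} {F f : ℝ → ℂ → ℂ} {lam : ℝ → ℝ} {w : ℂ}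
    (h : IsSlitChain c F f lam) (hlam : Continuous lam) (hw : ∀ t, w ∈ slitCompl c t) (t : ℝ) :
    HasDerivAt (fun s => F s w + (lam s : ℂ)) (2 / F t w) t := by
  have hc := h.continuous_flow hlam hw
  refine hasDerivAt_of_hasDerivWithinAt_Ioi (k := fun t => 2 / F t w)
    (hc.add (Complex.continuous_ofReal.comp hlam)) ?_ (h.hasDerivWithinAt_flow hlam hw) t
  exact continuous_const.div hc fun s =>
    norm_pos_iff.1 (norm_pos_of_mem_upperHalf (h.mapsTo s (hw s)))

/-! ### The square of a Loewner flow -/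

theorem absolutelyContinuousOnInterval_re {f : ℝ → ℂ} {a b : ℝ}
    (hf : AbsolutelyContinuousOnInterval f a b) :
    AbsolutelyContinuousOnInterval (fun t => (f t).re) a b := by
  refine squeeze_zero (fun t => Finset.sum_nonneg fun i _ => dist_nonneg) (fun t => ?_) hf
  refine Finset.sum_le_sum fun i _ => ?_
  rw [Real.dist_eq, dist_eq_norm, ← Complex.sub_re]
  exact Complex.abs_re_le_norm _

theorem norm_sq_sub_le_of_flow {l : ℝ → ℝ} {k : ℝ → ℂ} {a b M : ℝ} (hab : a ≤ b)
    (hl : AbsolutelyContinuousOnInterval l a b) (hk : Continuous k) (hk0 : ∀ t, k t ≠ 0)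
    (hd : ∀ t, HasDerivAt (fun s => k s + (l s : ℂ)) (2 / k t) t)
    (hM : ∀ t ∈ Icc a b, ‖k t‖ ≤ M) :
    ‖k b ^ 2 - k a ^ 2 - 4 * (b - a : ℝ)‖ ≤ 2 * M * ∫ t in a..b, |deriv l t| := by
  set v := k b ^ 2 - k a ^ 2 - 4 * (b - a : ℝ) with hv
  have hM0 : 0 ≤ M := (norm_nonneg _).trans (hM a (left_mem_Icc.2 hab))
  -- Rotating v onto the positive axis reduces the estimate to the fundamental theorem for one real
  -- absolutely continuous function, with no loss in the constant.
  obtain ⟨u, hu, huv⟩ : ∃ u : ℂ, ‖u‖ ≤ 1 ∧ (u * v).re = ‖v‖ := by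
    rcases eq_or_ne v 0 with h0 | h0
    · exact ⟨0, by simp, by simp [h0]⟩
    · have hn : ‖v‖ ≠ 0 := norm_ne_zero_iff.2 h0
      refine ⟨(starRingEnd ℂ) v / ‖v‖, ?_, ?_⟩
      · rw [norm_div, RCLike.norm_conj, Complex.norm_real, norm_norm, div_self hn]
      · have : (starRingEnd ℂ) v / ‖v‖ * v = (‖v‖ : ℂ) := by
          have hn' : (‖v‖ : ℂ) ≠ 0 := by exact_mod_cast hn
          rw [div_mul_eq_mul_div, Complex.conj_mul', pow_two, mul_div_assoc, div_self hn', mul_one]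
        rw [this, Complex.ofReal_re]
  have hconst : ∀ z : ℂ, AbsolutelyContinuousOnInterval (fun _ : ℝ => z) a b := fun z =>
    (contDiff_const (𝕜 := ℝ) (n := 1)).contDiffOn.absolutelyContinuousOnInterval
  have hlC : AbsolutelyContinuousOnInterval (fun t => (l t : ℂ)) a b := by
    have := hl.fun_smul (hconst 1)
    simpa using this
  have hgC : AbsolutelyContinuousOnInterval (fun t => k t + (l t : ℂ)) a b := by
    refine ContDiffOn.absolutelyContinuousOnInterval (ContDiff.contDiffOn ?_)
    rw [contDiff_one_iff_deriv]
    refine ⟨fun t => (hd t).differentiableAt, ?_⟩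
    rw [show deriv (fun t => k t + (l t : ℂ)) = fun t => 2 / k t from funext fun t => (hd t).deriv]
    exact continuous_const.div hk hk0
  have hkC : AbsolutelyContinuousOnInterval k a b := by
    have := hgC.fun_sub hlC
    simpa using this
  have h4C : AbsolutelyContinuousOnInterval (fun t : ℝ => 4 * (t : ℂ)) a b := by
    refine ContDiffOn.absolutelyContinuousOnInterval (ContDiff.contDiffOn ?_)
    exact contDiff_const.mul Complex.ofRealCLM.contDiff
  have hhC : AbsolutelyContinuousOnInterval (fun t => u • (k t • k t - 4 * (t : ℂ))) a b :=
    ((hkC.fun_smul hkC).fun_sub h4C).const_smul u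
  have hr := absolutelyContinuousOnInterval_re hhC
  have hint := hr.integral_deriv_eq_sub
  have hrv : (u • (k b • k b - 4 * (b : ℂ))).re - (u • (k a • k a - 4 * (a : ℂ))).re = ‖v‖ := by
    rw [← huv, ← Complex.sub_re, hv]
    congr 1
    simp only [smul_eq_mul]
    push_cast
    ring
  rw [← hrv, ← hint, ← intervalIntegral.integral_const_mul]
  refine (le_abs_self _).trans ?_
  rw [← Real.norm_eq_abs]
  refine intervalIntegral.norm_integral_le_of_norm_le hab ?_
    (hl.intervalIntegrable_deriv.abs.const_mul _)
  filter_upwards [hl.ae_differentiableAt] with t ht htab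
  have htI : t ∈ Icc a b := Ioc_subset_Icc_self htab
  have hlt := (ht (by rw [uIcc_of_le hab]; exact htI)).hasDerivAt.ofReal_comp
  have hkt : HasDerivAt k (2 / k t - ((deriv l t : ℝ) : ℂ)) t := by
    have := (hd t).fun_sub hlt
    simpa using this
  have h4 : HasDerivAt (fun t : ℝ => 4 * (t : ℂ)) 4 t := by
    simpa using (Complex.ofRealCLM.hasDerivAt (x := t)).const_mul (4 : ℂ)
  have hh : HasDerivAt (fun t => u • (k t • k t - 4 * (t : ℂ))) (-2 * u * k t * ((deriv l t : ℝ) : ℂ)) t := by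
    refine (((hkt.fun_mul hkt).sub h4).const_smul u).congr_deriv ?_
    have := hk0 t
    simp only [smul_eq_mul]
    field_simp
    ring
  have hre : HasDerivAt (fun t => (u • (k t • k t - 4 * (t : ℂ))).re)
      (-2 * u * k t * ((deriv l t : ℝ) : ℂ)).re t := Complex.reCLM.hasFDerivAt.comp_hasDerivAt t hh
  rw [hre.deriv, Real.norm_eq_abs]
  refine (Complex.abs_re_le_norm _).trans ?_
  rw [norm_mul, norm_mul, norm_mul, Complex.norm_real, Real.norm_eq_abs, norm_neg,
    Complex.norm_ofNat]
  have := hM t htI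
  gcongr
  nlinarith [norm_nonneg u, norm_nonneg (k t)]

/-! ### Growth of flows of finite energy -/

/-- A family of solutions of the Loewner equation on `D`, started from points of modulus `‖z‖`, with
driving function of speed `p`. -/
structure IsLoewnerFlow (k : ℝ → ℂ → ℂ) (D : Set ℂ) (p : ℝ → ℝ) : Prop where
  isOpen : IsOpen D
  norm_zero : ∀ z ∈ D, ‖k 0 z‖ = ‖z‖
  continuous : ∀ z ∈ D, Continuous fun t => k t z
  ne_zero : ∀ z ∈ D, ∀ t, k t z ≠ 0
  differentiableOn : ∀ t, DifferentiableOn ℂ (k t) D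
  deriv_ne_zero : ∀ t, ∀ z ∈ D, deriv (k t) z ≠ 0
  hasDerivAt_sub : ∀ z ∈ D, ∀ w ∈ D, ∀ t,
    HasDerivAt (fun s => k s z - k s w) (2 / k t z - 2 / k t w) t
  sq_sub_le : ∀ z ∈ D, ∀ a b M : ℝ, a ≤ b → (∀ t ∈ Icc a b, ‖k t z‖ ≤ M) →
    ‖k b z ^ 2 - k a z ^ 2 - 4 * (b - a : ℝ)‖ ≤ 2 * M * ∫ t in a..b, p t
  intervalIntegrable : ∀ a b, IntervalIntegrable p volume a b
  integrable_sq : Integrable fun t => p t ^ 2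

namespace IsLoewnerFlow

variable {k : ℝ → ℂ → ℂ} {D : Set ℂ} {p : ℝ → ℝ}

/-- Cauchy–Schwarz in weighted form, p ≤ θ/2 + p²/(2θ); taking θ of order 1/√t balances the two
terms. -/
theorem integral_speed_le (h : IsLoewnerFlow k D p) {a b θ : ℝ} (hab : a ≤ b) (hθ : 0 < θ) :
    ∫ t in a..b, p t ≤ (θ * (b - a) + (∫ t in a..b, p t ^ 2) / θ) / 2 := by
  have h1 : ∫ t in a..b, p t ≤ ∫ t in a..b, (θ / 2 + p t ^ 2 / (2 * θ)) := by
    have hi : IntervalIntegrable (fun t => p t ^ 2) volume a b :=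
      h.integrable_sq.intervalIntegrable
    refine intervalIntegral.integral_mono_on hab (h.intervalIntegrable a b)
      (intervalIntegrable_const.add (hi.div_const _)) fun t _ => ?_
    have h2 : θ / 2 + p t ^ 2 / (2 * θ) - p t = (θ - p t) ^ 2 / (2 * θ) := by
      field_simp; ring
    have h3 : 0 ≤ (θ - p t) ^ 2 / (2 * θ) := by positivity
    linarith
  refine h1.trans (le_of_eq ?_)
  rw [intervalIntegral.integral_add intervalIntegrable_const
    (h.integrable_sq.intervalIntegrable.div_const _), intervalIntegral.integral_const,
    intervalIntegral.integral_div, smul_eq_mul]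
  field_simp

theorem integral_sq_le (h : IsLoewnerFlow k D p) {a b : ℝ} (hab : a ≤ b) :
    ∫ t in a..b, p t ^ 2 ≤ ∫ t, p t ^ 2 := by
  rw [intervalIntegral.integral_of_le hab]
  exact setIntegral_le_integral h.integrable_sq (Eventually.of_forall fun t => sq_nonneg _)

/-- The maximum M of |k| on [0, t] satisfies M² ≤ |z|² + 4t + M√t(1 + E) with E the integral of p².
Half of M² absorbs the last term, which produces N = 8 + (1 + E)². -/
theorem norm_sq_le (h : IsLoewnerFlow k D p) : ∃ N : ℝ, 1 ≤ N ∧ ∀ z ∈ D, ∀ t : ℝ, 0 < t →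
    ∀ s ∈ Icc 0 t, ‖k s z‖ ^ 2 ≤ 2 * ‖z‖ ^ 2 + N * t := by
  set E := ∫ t, p t ^ 2 with hE
  have hE0 : 0 ≤ E := integral_nonneg fun t => sq_nonneg _
  refine ⟨8 + (1 + E) ^ 2, by nlinarith, fun z hz t ht s hs => ?_⟩
  obtain ⟨m, hm, hmax⟩ := isCompact_Icc.exists_isMaxOn (nonempty_Icc.2 ht.le)
    (h.continuous z hz).norm.continuousOn
  set M := ‖k m z‖ with hM
  have hM0 : 0 ≤ M := norm_nonneg _
  have hle : ∀ r ∈ Icc 0 t, ‖k r z‖ ≤ M := fun r hr => hmax hr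
  have h1 := h.sq_sub_le z hz 0 m M hm.1 fun r hr => hle r ⟨hr.1, hr.2.trans hm.2⟩
  have hq : 0 < Real.sqrt t := Real.sqrt_pos.2 ht
  have hqq : Real.sqrt t ^ 2 = t := Real.sq_sqrt ht.le
  set q := Real.sqrt t
  have h2 := h.integral_speed_le (θ := q⁻¹) hm.1 (by positivity)
  have h3 := h.integral_sq_le hm.1
  have h4 : ∫ r in (0 : ℝ)..m, p r ≤ q * (1 + E) / 2 := by
    refine h2.trans ?_
    have e1 : q⁻¹ * (m - 0) ≤ q := by
      rw [sub_zero, inv_mul_le_iff₀ hq]; nlinarith [hm.2]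
    have e2 : (∫ r in (0 : ℝ)..m, p r ^ 2) / q⁻¹ ≤ q * E := by
      rw [div_inv_eq_mul, mul_comm]
      exact mul_le_mul_of_nonneg_left h3 hq.le
    linarith
  have h5 : M ^ 2 ≤ ‖z‖ ^ 2 + 4 * t + M * (q * (1 + E)) := by
    have e1 : ‖k m z ^ 2‖ ≤ ‖k m z ^ 2 - k 0 z ^ 2 - 4 * (m - 0 : ℝ)‖ + ‖k 0 z ^ 2‖
        + ‖(4 * (m - 0 : ℝ) : ℂ)‖ := by
      calc ‖k m z ^ 2‖ = ‖(k m z ^ 2 - k 0 z ^ 2 - 4 * (m - 0 : ℝ)) + k 0 z ^ 2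
            + 4 * (m - 0 : ℝ)‖ := by ring_nf
        _ ≤ _ := (norm_add_le _ _).trans (by gcongr; exact norm_add_le _ _)
    rw [norm_pow, norm_pow, h.norm_zero z hz, norm_mul, Complex.norm_real, Complex.norm_ofNat,
      Real.norm_eq_abs, sub_zero, abs_of_nonneg hm.1] at e1
    have e2 : 2 * M * ∫ r in (0 : ℝ)..m, p r ≤ 2 * M * (q * (1 + E) / 2) := by gcongr
    rw [sub_zero] at h1
    have := hm.2
    linarith
  have h6 : ‖k s z‖ ^ 2 ≤ M ^ 2 := by
    have := hle s hs
    gcongr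
  have h7 : 2 * (M * (q * (1 + E))) ≤ M ^ 2 + t * (1 + E) ^ 2 := by
    rw [← hqq]
    nlinarith [sq_nonneg (M - q * (1 + E))]
  nlinarith

theorem exists_tail (h : IsLoewnerFlow k D p) {η : ℝ} (hη : 0 < η) :
    ∃ T : ℝ, 1 ≤ T ∧ ∀ t, T ≤ t → ∫ s in T..t, p s ^ 2 ≤ η := by
  have hlim := intervalIntegral_tendsto_integral_Ioi (0 : ℝ) h.integrable_sq.integrableOn
    tendsto_id
  set L := ∫ s in Ioi (0 : ℝ), p s ^ 2
  have h1 : ∀ᶠ T in atTop, L - η < ∫ s in (0 : ℝ)..id T, p s ^ 2 :=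
    hlim.eventually (lt_mem_nhds (by linarith))
  obtain ⟨T, hT, hT1⟩ := (h1.and (eventually_ge_atTop 1)).exists
  refine ⟨T, hT1, fun t ht => ?_⟩
  have h2 : ∫ s in (0 : ℝ)..t, p s ^ 2 ≤ L := by
    rw [intervalIntegral.integral_of_le (by linarith)]
    exact setIntegral_mono_set h.integrable_sq.integrableOn
      (Eventually.of_forall fun t => sq_nonneg _) (Eventually.of_forall Ioc_subset_Ioi_self)
  have h3 := intervalIntegral.integral_add_adjacent_intervals
    (h.integrable_sq.intervalIntegrable (a := 0) (b := T))
    (h.integrable_sq.intervalIntegrable (a := T) (b := t))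
  simp only [id] at hT
  linarith

/-- Start at a time T after which the integral of p² is at most ν². The a priori bound |k| ≤ (N +
1)√t and ∫p ≤ ν√t on [T, t] give an error 2εt there; the contribution A of the time before T is at
most εt for large t. -/
theorem sq_div_tendsto (h : IsLoewnerFlow k D p) (R : ℝ) {ε : ℝ} (hε : 0 < ε) :
    ∃ T : ℝ, 1 ≤ T ∧ ∀ t, T ≤ t → ∀ z ∈ D, ‖z‖ ≤ R → ‖k t z ^ 2 / (4 * (t : ℂ)) - 1‖ ≤ ε := by
  obtain ⟨N, hN1, hN⟩ := h.norm_sq_le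
  set ν := ε / (N + 1) with hν
  have hν0 : 0 < ν := by positivity
  obtain ⟨T, hT1, hT⟩ := h.exists_tail (η := ν ^ 2) (by positivity)
  set A := 2 * R ^ 2 + (N + 4) * T with hA
  have hA0 : 0 ≤ A := by positivity
  refine ⟨max T (max (2 * R ^ 2) (A / ε)), hT1.trans (le_max_left _ _), fun t ht z hz hzR => ?_⟩
  have htT : T ≤ t := (le_max_left _ _).trans ht
  have htR : 2 * R ^ 2 ≤ t := ((le_max_left _ _).trans (le_max_right _ _)).trans ht
  have htA : A / ε ≤ t := ((le_max_right _ _).trans (le_max_right _ _)).trans ht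
  have ht0 : 0 < t := by linarith
  have hR2 : ‖z‖ ^ 2 ≤ R ^ 2 := by
    have := norm_nonneg z
    gcongr
  have hq : 0 < Real.sqrt t := Real.sqrt_pos.2 ht0
  have hqq : Real.sqrt t ^ 2 = t := Real.sq_sqrt ht0.le
  set q := Real.sqrt t
  have hM : ∀ s ∈ Icc T t, ‖k s z‖ ≤ (N + 1) * q := by
    intro s hs
    have h1 := hN z hz t ht0 s ⟨by linarith [hs.1], hs.2⟩
    have h2 : ‖k s z‖ ^ 2 ≤ ((N + 1) * q) ^ 2 := by
      rw [mul_pow, hqq]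
      nlinarith
    exact le_of_sq_le_sq h2 (by positivity)
  have h1 := h.sq_sub_le z hz T t _ htT hM
  have h2 : ∫ s in T..t, p s ≤ ν * q := by
    refine (h.integral_speed_le (θ := ν / q) htT (by positivity)).trans ?_
    have e1 : ν / q * (t - T) ≤ ν * q := by
      rw [div_mul_eq_mul_div, div_le_iff₀ hq]
      nlinarith
    have e2 : (∫ s in T..t, p s ^ 2) / (ν / q) ≤ ν * q := by
      rw [div_le_iff₀ (by positivity)]
      refine (hT t htT).trans (le_of_eq ?_)
      field_simp
    linarith
  have h3 : ‖k t z ^ 2 - k T z ^ 2 - 4 * (t - T : ℝ)‖ ≤ 2 * ε * t := by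
    refine h1.trans ((mul_le_mul_of_nonneg_left h2 (by positivity)).trans (le_of_eq ?_))
    rw [← hqq, hν]
    field_simp
  have h4 := hN z hz T (by linarith) T ⟨by linarith, le_rfl⟩
  have h5 : ‖k t z ^ 2 - 4 * (t : ℂ)‖ ≤ 2 * ε * t + A := by
    calc ‖k t z ^ 2 - 4 * (t : ℂ)‖
        = ‖(k t z ^ 2 - k T z ^ 2 - 4 * (t - T : ℝ)) + k T z ^ 2 - 4 * (T : ℝ)‖ := by
          congr 1; push_cast; ring
      _ ≤ ‖k t z ^ 2 - k T z ^ 2 - 4 * (t - T : ℝ)‖ + ‖k T z ^ 2‖ + ‖(4 * (T : ℝ) : ℂ)‖ :=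
          (norm_sub_le _ _).trans (by gcongr; exact norm_add_le _ _)
      _ ≤ 2 * ε * t + A := by
          rw [norm_pow, norm_mul, Complex.norm_real, Complex.norm_ofNat, Real.norm_eq_abs,
            abs_of_pos (by linarith : 0 < T)]
          nlinarith
  have htne : (t : ℂ) ≠ 0 := by exact_mod_cast ht0.ne'
  have e : k t z ^ 2 / (4 * (t : ℂ)) - 1 = (k t z ^ 2 - 4 * (t : ℂ)) / (4 * t : ℝ) := by
    push_cast; field_simp
  rw [e, norm_div, Complex.norm_real, Real.norm_eq_abs, abs_of_pos (by positivity),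
    div_le_iff₀ (by positivity)]
  rw [div_le_iff₀ hε] at htA
  nlinarith

end IsLoewnerFlow

/-! ### Size of the spatial derivative -/

theorem norm_deriv_mul_le_of_norm_sub_mul_le {f g : ℂ → ℂ} {z : ℂ} {A B : ℝ}
    (hf : DifferentiableAt ℂ f z) (hg : DifferentiableAt ℂ g z)
    (h : ∀ᶠ w in 𝓝 z, ‖f w - f z‖ ^ 2 * A ≤ ‖g w - g z‖ ^ 2 * B) :
    ‖deriv f z‖ ^ 2 * A ≤ ‖deriv g z‖ ^ 2 * B := by
  have hf' := (((hasDerivAt_iff_tendsto_slope.1 hf.hasDerivAt).norm.pow 2).mul_const A)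
  have hg' := (((hasDerivAt_iff_tendsto_slope.1 hg.hasDerivAt).norm.pow 2).mul_const B)
  refine le_of_tendsto_of_tendsto hf' hg' ?_
  filter_upwards [h.filter_mono nhdsWithin_le_nhds, self_mem_nhdsWithin] with w hw hwz
  have hpos : 0 < ‖w - z‖ ^ 2 := by
    have : w - z ≠ 0 := sub_ne_zero.2 hwz
    positivity
  rw [slope_def_field, slope_def_field, norm_div, norm_div, div_pow, div_pow, div_mul_eq_mul_div,
    div_mul_eq_mul_div]
  gcongr

theorem norm_sub_one_le_of_re_pos {q : ℂ} (hq : 0 < q.re) : ‖q - 1‖ ≤ ‖q ^ 2 - 1‖ := by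
  have h1 : 1 ≤ ‖q + 1‖ := by
    have := (le_abs_self _).trans (Complex.abs_re_le_norm (q + 1))
    rw [Complex.add_re, Complex.one_re] at this
    linarith
  have h2 : q ^ 2 - 1 = (q + 1) * (q - 1) := by ring
  rw [h2, norm_mul]
  nlinarith [norm_nonneg (q - 1)]

theorem abs_re_inv_sub_one_le {q : ℂ} {κ : ℝ} (hκ : κ ≤ 1 / 2) (hq : ‖q - 1‖ ≤ κ) :
    |(q⁻¹).re - 1| ≤ 2 * κ := by
  have h1 : 1 / 2 ≤ ‖q‖ := by
    have := norm_sub_norm_le (1 : ℂ) (1 - q)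
    rw [sub_sub_cancel, norm_one, norm_sub_rev] at this
    linarith
  have hq0 : q ≠ 0 := norm_pos_iff.1 (by linarith)
  have h2 : ‖q⁻¹ - 1‖ ≤ 2 * κ := by
    have e : q⁻¹ - 1 = -(q - 1) / q := by field_simp; ring
    rw [e, norm_div, norm_neg, div_le_iff₀ (by linarith)]
    nlinarith [norm_nonneg (q - 1)]
  have := (Complex.abs_re_le_norm (q⁻¹ - 1)).trans h2
  simpa using this

namespace IsLoewnerFlow

variable {k : ℝ → ℂ → ℂ} {D : Set ℂ} {p : ℝ → ℝ}

/-- Closeness of both squares to 4t determines k(z)k(w)/(4t) only up to sign. Its real part never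
vanishes as w runs over the ball and is positive at w = z, so connectedness of the ball fixes the
sign. -/
theorem norm_mul_div_sub_one_le (h : IsLoewnerFlow k D p) {z₀ : ℂ} {r t κ : ℝ}
    (hball : Metric.ball z₀ r ⊆ D) (hκ : κ ≤ 1 / 6) (ht : 0 < t)
    (hb : ∀ z ∈ Metric.ball z₀ r, ‖k t z ^ 2 / (4 * (t : ℂ)) - 1‖ ≤ κ) {z w : ℂ}
    (hz : z ∈ Metric.ball z₀ r) (hw : w ∈ Metric.ball z₀ r) :
    ‖k t z * k t w / (4 * (t : ℂ)) - 1‖ ≤ 3 * κ := by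
  have htne : (t : ℂ) ≠ 0 := by exact_mod_cast ht.ne'
  have hκ0 : 0 ≤ κ := (norm_nonneg _).trans (hb z hz)
  set q : ℂ → ℂ := fun w => k t z * k t w / (4 * (t : ℂ)) with hq
  have hsq : ∀ w ∈ Metric.ball z₀ r, ‖q w ^ 2 - 1‖ ≤ 3 * κ := by
    intro w hw
    set a := k t z ^ 2 / (4 * (t : ℂ)) with ha
    set b := k t w ^ 2 / (4 * (t : ℂ)) with hb'
    have e : q w ^ 2 - 1 = (a - 1) * (b - 1) + (a - 1) + (b - 1) := by
      rw [hq, ha, hb']; field_simp; ring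
    have h1 := hb z hz
    have h2 := hb w hw
    rw [e]
    have h3 : ‖(a - 1) * (b - 1)‖ ≤ κ * κ := by rw [norm_mul]; gcongr
    have h4 := norm_add₃_le (a := (a - 1) * (b - 1)) (b := a - 1) (c := b - 1)
    nlinarith
  have hne : ∀ w ∈ Metric.ball z₀ r, (q w).re ≠ 0 := by
    intro w hw h0
    have h1 := hsq w hw
    have h2 := (neg_le_abs _).trans (Complex.abs_re_le_norm (q w ^ 2 - 1))
    rw [Complex.sub_re, pow_two, Complex.mul_re, h0, Complex.one_re] at h2
    rw [pow_two] at h1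
    nlinarith [mul_self_nonneg (q w).im]
  have hz0 : 0 < (q z).re := by
    have h1 := (neg_le_abs _).trans ((Complex.abs_re_le_norm _).trans (hb z hz))
    rw [Complex.sub_re, Complex.one_re] at h1
    have : q z = k t z ^ 2 / (4 * (t : ℂ)) := by rw [hq]; ring
    rw [this]
    linarith
  have hw0 : 0 < (q w).re := by
    by_contra! hle
    have hc : ContinuousOn (fun w => (q w).re) (Metric.ball z₀ r) := by
      refine Complex.continuous_re.comp_continuousOn ?_
      exact (continuousOn_const.mul ((h.differentiableOn t).continuousOn.mono hball)).div_const _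
    obtain ⟨v, hv, hv0⟩ := (convex_ball z₀ r).isPreconnected.intermediate_value hw hz hc
      ⟨hle, hz0.le⟩
    exact hne v hv hv0
  exact (norm_sub_one_le_of_re_pos hw0).trans (hsq w hw)

/-- Squared distances between solutions decay like `1 / t`, up to small powers. -/
theorem norm_sub_sq_mul_rpow (h : IsLoewnerFlow k D p) {z w : ℂ} (hz : z ∈ D) (hw : w ∈ D)
    {T κ : ℝ} (hT : 0 < T)
    (hb : ∀ t, T ≤ t → |((k t z * k t w / (4 * (t : ℂ)))⁻¹).re - 1| ≤ κ) {t : ℝ} (ht : T ≤ t) :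
    ‖k t w - k t z‖ ^ 2 * t ^ (1 - κ) ≤ ‖k T w - k T z‖ ^ 2 * T ^ (1 - κ) ∧
      ‖k T w - k T z‖ ^ 2 * T ^ (1 + κ) ≤ ‖k t w - k t z‖ ^ 2 * t ^ (1 + κ) := by
  set n : ℝ → ℝ := fun t => ‖k t w - k t z‖ ^ 2 with hn
  set ρ : ℝ → ℝ := fun t => ((k t z * k t w / (4 * (t : ℂ)))⁻¹).re with hρ
  -- The logarithmic derivative of the squared distance is -ρ/t, so the factor t^α makes the product
  -- monotone according to the sign of α - ρ. The exponents α = 1 ∓ κ give the two inequalities.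
  have hder : ∀ t, T ≤ t → ∀ α : ℝ, HasDerivAt (fun t => n t * t ^ α)
      (n t * t ^ (α - 1) * (α - ρ t)) t := by
    intro t ht α
    have ht0 : 0 < t := hT.trans_le ht
    have htne : (t : ℂ) ≠ 0 := by exact_mod_cast ht0.ne'
    have h1 := (h.hasDerivAt_sub w hw z hz t).norm_sq
    have h2 := Real.hasDerivAt_rpow_const (x := t) (p := α) (Or.inl ht0.ne')
    refine (h1.mul h2).congr_deriv ?_
    have hkz := h.ne_zero z hz t
    have hkw := h.ne_zero w hw t
    have e1 : 2 / k t w - 2 / k t z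
        = -((1 / (2 * t) : ℝ) : ℂ) * ((k t z * k t w / (4 * (t : ℂ)))⁻¹ * (k t w - k t z)) := by
      push_cast; field_simp; ring
    have e2 : inner ℝ (k t w - k t z) (2 / k t w - 2 / k t z) = -(1 / (2 * t)) * (ρ t * n t) := by
      rw [e1, ← Complex.ofReal_neg, ← Complex.real_smul, inner_smul_right, Complex.inner]
      congr 1
      have e4 : ∀ x : ℂ, x = (k t z * k t w / (4 * (t : ℂ)))⁻¹ *
          ((starRingEnd ℂ) (k t w - k t z) * (k t w - k t z)) → x.re = ρ t * n t := by
        rintro x rfl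
        rw [Complex.conj_mul', ← Complex.ofReal_pow, Complex.re_mul_ofReal]
      exact e4 _ (by ring)
    have e3 : t ^ α = t * t ^ (α - 1) := by
      rw [Real.rpow_sub_one ht0.ne']; field_simp
    rw [e2, e3]
    simp only [hn]
    field_simp
    ring
  have hcont : ∀ α : ℝ, ContinuousOn (fun t => n t * t ^ α) (Ici T) := fun α t ht =>
    (hder t ht α).continuousAt.continuousWithinAt
  have hdiff : ∀ α : ℝ, DifferentiableOn ℝ (fun t => n t * t ^ α) (interior (Ici T)) :=
    fun α t ht => (hder t (interior_subset ht) α).differentiableAt.differentiableWithinAt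
  have hnn : ∀ t, T ≤ t → ∀ α : ℝ, 0 ≤ n t * t ^ α := fun t ht α =>
    mul_nonneg (sq_nonneg _) (Real.rpow_nonneg (hT.le.trans ht) _)
  constructor
  · refine antitoneOn_of_deriv_nonpos (convex_Ici T) (hcont (1 - κ)) (hdiff _) (fun s hs => ?_)
      self_mem_Ici ht ht
    have hs' : T ≤ s := interior_subset hs
    rw [(hder s hs' _).deriv]
    refine mul_nonpos_of_nonneg_of_nonpos (hnn s hs' _) ?_
    linarith [(abs_le.1 (hb s hs')).1]
  · refine monotoneOn_of_deriv_nonneg (convex_Ici T) (hcont (1 + κ)) (hdiff _) (fun s hs => ?_)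
      self_mem_Ici ht ht
    have hs' : T ≤ s := interior_subset hs
    rw [(hder s hs' _).deriv]
    refine mul_nonneg (hnn s hs' _) ?_
    linarith [(abs_le.1 (hb s hs')).2]

/-- Letting w → z in the two distance inequalities compares |k_t'| with |k_T'| at a fixed time T. On
a closed ball log|k_T'| is bounded by compactness, so it is negligible against log t. -/
theorem log_deriv_div_log_tendsto (h : IsLoewnerFlow k D p) {z₀ : ℂ} (hz₀ : z₀ ∈ D) {ε : ℝ}
    (hε : 0 < ε) : ∃ r > 0, Metric.ball z₀ r ⊆ D ∧ ∃ T : ℝ, ∀ t, T ≤ t →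
      ∀ z ∈ Metric.ball z₀ r, |Real.log ‖deriv (k t) z‖ / Real.log t + 1 / 2| ≤ ε := by
  obtain ⟨r, hr, hrD⟩ := Metric.nhds_basis_closedBall.mem_iff.1 (h.isOpen.mem_nhds hz₀)
  have hball : Metric.ball z₀ r ⊆ D := Metric.ball_subset_closedBall.trans hrD
  refine ⟨r, hr, hball, ?_⟩
  -- The product is within 3κ of 1 and its inverse within 6κ; this needs 3κ ≤ 1/2, and 6κ ≤ ε is the
  -- admissible loss in the exponent.
  set κ := min (ε / 6) (1 / 6) with hκ
  have hκ0 : 0 < κ := by positivity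
  have hκ6 : κ ≤ 1 / 6 := min_le_right _ _
  have hκε : κ ≤ ε / 6 := min_le_left _ _
  obtain ⟨T, hT1, hT⟩ := h.sq_div_tendsto (‖z₀‖ + r) hκ0
  have hT0 : 0 < T := by linarith
  have hbd : ∀ t, T ≤ t → ∀ z ∈ Metric.ball z₀ r, ‖k t z ^ 2 / (4 * (t : ℂ)) - 1‖ ≤ κ := by
    intro t ht z hz
    refine hT t ht z (hball hz) ?_
    have h1 : ‖z - z₀‖ < r := by simpa [dist_eq_norm] using hz
    have h2 := norm_le_norm_add_norm_sub' z z₀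
    linarith
  have hdT : DifferentiableOn ℂ (deriv (k T)) D := (h.differentiableOn T).deriv h.isOpen
  obtain ⟨C, hC⟩ := (isCompact_closedBall z₀ r).exists_bound_of_continuousOn
    (f := fun z => Real.log ‖deriv (k T) z‖)
    ((hdT.continuousOn.mono hrD).norm.log fun z hz =>
      norm_ne_zero_iff.2 (h.deriv_ne_zero T z (hrD hz)))
  have hC0 : 0 ≤ C := (norm_nonneg _).trans (hC z₀ (Metric.mem_closedBall_self hr.le))
  have hlT : 0 ≤ Real.log T := Real.log_nonneg hT1
  have hev : ∀ᶠ t in atTop, (C + Real.log T) * 2 / ε + 1 ≤ Real.log t :=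
    Real.tendsto_log_atTop.eventually_ge_atTop _
  obtain ⟨T', hT'⟩ := eventually_atTop.1 hev
  refine ⟨max T T', fun t ht z hz => ?_⟩
  have htT : T ≤ t := (le_max_left _ _).trans ht
  have ht0 : 0 < t := by linarith
  have hlog := hT' t ((le_max_right _ _).trans ht)
  have hl0 : 0 < Real.log t := by
    have : 0 ≤ (C + Real.log T) * 2 / ε := by positivity
    linarith
  have hpair : ∀ w ∈ Metric.ball z₀ r, ∀ s, T ≤ s →
      |((k s z * k s w / (4 * (s : ℂ)))⁻¹).re - 1| ≤ 6 * κ := by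
    intro w hw s hs
    have h1 := h.norm_mul_div_sub_one_le hball hκ6 (by linarith) (hbd s hs) hz hw
    refine (abs_re_inv_sub_one_le (by linarith) h1).trans (by linarith)
  have hdiff : ∀ s, DifferentiableAt ℂ (k s) z := fun s =>
    (h.differentiableOn s).differentiableAt (h.isOpen.mem_nhds (hball hz))
  have hnear : ∀ᶠ w in 𝓝 z, w ∈ Metric.ball z₀ r := Metric.isOpen_ball.mem_nhds hz
  have hup := norm_deriv_mul_le_of_norm_sub_mul_le (hdiff t) (hdiff T) (hnear.mono fun w hw =>
    (h.norm_sub_sq_mul_rpow (hball hz) (hball hw) hT0 (hpair w hw) htT).1)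
  have hlo := norm_deriv_mul_le_of_norm_sub_mul_le (hdiff T) (hdiff t) (hnear.mono fun w hw =>
    (h.norm_sub_sq_mul_rpow (hball hz) (hball hw) hT0 (hpair w hw) htT).2)
  have hpos : ∀ s, 0 < ‖deriv (k s) z‖ := fun s => norm_pos_iff.2 (h.deriv_ne_zero s z (hball hz))
  have hlogmul : ∀ s α : ℝ, 0 < s → Real.log (‖deriv (k s) z‖ ^ 2 * s ^ α)
      = 2 * Real.log ‖deriv (k s) z‖ + α * Real.log s := by
    intro s α hs
    rw [Real.log_mul (pow_pos (hpos s) 2).ne' (Real.rpow_pos_of_pos hs _).ne', Real.log_pow,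
      Real.log_rpow hs]
    push_cast; ring
  have hup' := Real.log_le_log (mul_pos (pow_pos (hpos t) 2) (Real.rpow_pos_of_pos ht0 _)) hup
  have hlo' := Real.log_le_log (mul_pos (pow_pos (hpos T) 2) (Real.rpow_pos_of_pos hT0 _)) hlo
  rw [hlogmul t _ ht0, hlogmul T _ hT0] at hup'
  rw [hlogmul t _ ht0, hlogmul T _ hT0] at hlo'
  have hCz := abs_le.1 (hC z (Metric.ball_subset_closedBall hz))
  have hmain : C + Real.log T ≤ ε / 2 * Real.log t := by
    have e : (C + Real.log T) * 2 / ε ≤ Real.log t := by linarith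
    rw [div_le_iff₀ hε] at e
    linarith
  have e : Real.log ‖deriv (k t) z‖ / Real.log t + 1 / 2
      = (2 * Real.log ‖deriv (k t) z‖ + Real.log t) / (2 * Real.log t) := by
    field_simp
  rw [e, abs_div, abs_of_pos (by positivity : 0 < 2 * Real.log t), div_le_iff₀ (by positivity),
    abs_le]
  have hκl : 6 * κ * Real.log t ≤ ε * Real.log t := by gcongr; linarith
  have hκT : 6 * κ * Real.log T ≤ 1 * Real.log T := by gcongr; linarith
  have hκT0 : 0 ≤ 6 * κ * Real.log T := by positivity
  constructor <;> nlinarith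

end IsLoewnerFlow

/-! ### From slit chains to flows in both time directions -/

/-- The points of the upper half-plane which are never swallowed. -/
def liveDomain (c : ℝ → ℂ) (F : ℝ → ℂ → ℂ) : Set ℂ :=
  {z | z ∈ upperHalf ∧ ∀ t, slitInv c F 0 z ∈ slitCompl c t}

namespace IsSlitChain

variable {c : ℝ → ℂ} {F f : ℝ → ℂ → ℂ} {lam : ℝ → ℝ}

theorem chain_apply (h : IsSlitChain c F f lam) (t : ℝ) {z : ℂ} (hz : z ∈ upperHalf) :
    f t z = F t (slitInv c F 0 z) := by
  have := h.conj t _ (h.slitInv_mem 0 hz)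
  rwa [h.apply_slitInv 0 hz] at this

theorem isOpen_liveDomain (h : IsSlitChain c F f lam)
    (hW : IsOpen {u : ℂ | ∀ r, c r ≠ u}) : IsOpen (liveDomain c F) := by
  have : liveDomain c F = upperHalf ∩ slitInv c F 0 ⁻¹' {u : ℂ | ∀ r, c r ≠ u} := by
    ext z
    refine and_congr_right fun _ => ⟨fun hz r => hz r r le_rfl, fun hz t r _ => hz r⟩
  rw [this]
  exact (h.differentiableOn_slitInv 0).continuousOn.isOpen_inter_preimage isOpen_upperHalf hW

theorem chain_mem (h : IsSlitChain c F f lam) {z : ℂ} (hz : z ∈ liveDomain c F) (t : ℝ) :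
    f t z ∈ upperHalf := by
  rw [h.chain_apply t hz.1]
  exact h.mapsTo t (hz.2 t)

theorem chain_ne_zero (h : IsSlitChain c F f lam) {z : ℂ} (hz : z ∈ liveDomain c F) (t : ℝ) :
    f t z ≠ 0 := norm_pos_iff.1 (norm_pos_of_mem_upperHalf (h.chain_mem hz t))

theorem chain_zero (h : IsSlitChain c F f lam) {z : ℂ} (hz : z ∈ liveDomain c F) :
    f 0 z = z := by
  rw [h.chain_apply 0 hz.1, h.apply_slitInv 0 hz.1]

theorem differentiableOn_chain (h : IsSlitChain c F f lam) (t : ℝ) :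
    DifferentiableOn ℂ (f t) (liveDomain c F) := by
  have h1 : DifferentiableOn ℂ (fun z => F t (slitInv c F 0 z)) (liveDomain c F) :=
    (h.differentiableOn t).comp ((h.differentiableOn_slitInv 0).mono fun z hz => hz.1)
      fun z hz => hz.2 t
  exact h1.congr fun z hz => h.chain_apply t hz.1

theorem injOn_chain (h : IsSlitChain c F f lam) (t : ℝ) : InjOn (f t) (liveDomain c F) := by
  intro z hz w hw hzw
  rw [h.chain_apply t hz.1, h.chain_apply t hw.1] at hzw
  have h1 := (h.bijOn t).injOn (hz.2 t) (hw.2 t) hzw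
  rw [← h.apply_slitInv 0 hz.1, h1, h.apply_slitInv 0 hw.1]

theorem continuous_chain (h : IsSlitChain c F f lam) (hlam : Continuous lam) {z : ℂ}
    (hz : z ∈ liveDomain c F) : Continuous fun t => f t z := by
  simp_rw [fun t => h.chain_apply t hz.1]
  exact h.continuous_flow hlam hz.2

theorem hasDerivAt_chain (h : IsSlitChain c F f lam) (hlam : Continuous lam) {z : ℂ}
    (hz : z ∈ liveDomain c F) (t : ℝ) :
    HasDerivAt (fun s => f s z + (lam s : ℂ)) (2 / f t z) t := by
  simp_rw [fun t => h.chain_apply t hz.1]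
  exact h.hasDerivAt_flow hlam hz.2 t

theorem hasDerivAt_chain_sub (h : IsSlitChain c F f lam) (hlam : Continuous lam) {z w : ℂ}
    (hz : z ∈ liveDomain c F) (hw : w ∈ liveDomain c F) (t : ℝ) :
    HasDerivAt (fun s => f s z - f s w) (2 / f t z - 2 / f t w) t := by
  simpa using (h.hasDerivAt_chain hlam hz t).fun_sub (h.hasDerivAt_chain hlam hw t)

theorem isLoewnerFlow (h : IsSlitChain c F f lam) (hW : IsOpen {u : ℂ | ∀ r, c r ≠ u})
    (hlam : Continuous lam) (hac : ∀ a b, AbsolutelyContinuousOnInterval lam a b)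
    (hE : Integrable fun t => (deriv lam t) ^ 2) :
    IsLoewnerFlow f (liveDomain c F) (fun t => |deriv lam t|) where
  isOpen := h.isOpen_liveDomain hW
  norm_zero := fun z hz => by rw [h.chain_zero hz]
  continuous := fun z hz => h.continuous_chain hlam hz
  ne_zero := fun z hz t => h.chain_ne_zero hz t
  differentiableOn := h.differentiableOn_chain
  deriv_ne_zero := fun t z hz => deriv_ne_zero_of_injOn (h.isOpen_liveDomain hW)
    (h.differentiableOn_chain t) (h.injOn_chain t) hz
  hasDerivAt_sub := fun z hz w hw t => h.hasDerivAt_chain_sub hlam hz hw t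
  sq_sub_le := fun z hz a b M hab hM => by
    have h1 := norm_sq_sub_le_of_flow (M := M) hab (hac a b) (h.continuous_chain hlam hz)
      (h.chain_ne_zero hz) (h.hasDerivAt_chain hlam hz) hM
    exact h1
  intervalIntegrable := fun a b => (hac a b).intervalIntegrable_deriv.abs
  integrable_sq := by simpa only [sq_abs] using hE

/-- Reversing time changes the sign of the vector field 2/f, and multiplication by i restores it
because -i · 2/f = 2/(if). The square becomes -f², so growth like 4t is again the right
normalization. -/
theorem isLoewnerFlow_reverse (h : IsSlitChain c F f lam)
    (hW : IsOpen {u : ℂ | ∀ r, c r ≠ u}) (hlam : Continuous lam)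
    (hac : ∀ a b, AbsolutelyContinuousOnInterval lam a b)
    (hE : Integrable fun t => (deriv lam t) ^ 2) :
    IsLoewnerFlow (fun t z => Complex.I * f (-t) z) (liveDomain c F)
      (fun t => |deriv lam (-t)|) where
  isOpen := h.isOpen_liveDomain hW
  norm_zero := fun z hz => by simp [h.chain_zero hz]
  continuous := fun z hz => continuous_const.mul ((h.continuous_chain hlam hz).comp continuous_neg)
  ne_zero := fun z hz t => mul_ne_zero Complex.I_ne_zero (h.chain_ne_zero hz _)
  differentiableOn := fun t => (h.differentiableOn_chain (-t)).const_mul _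
  deriv_ne_zero := fun t z hz => by
    rw [deriv_const_mul_field]
    exact mul_ne_zero Complex.I_ne_zero (deriv_ne_zero_of_injOn (h.isOpen_liveDomain hW)
      (h.differentiableOn_chain _) (h.injOn_chain _) hz)
  hasDerivAt_sub := fun z hz w hw t => by
    have h1 := (HasDerivAt.scomp t (h.hasDerivAt_chain_sub hlam hz hw (-t))
      (hasDerivAt_neg t)).const_mul Complex.I
    have hzne := h.chain_ne_zero hz (-t)
    have hwne := h.chain_ne_zero hw (-t)
    refine (h1.congr_deriv ?_).congr_of_eventuallyEq (Eventually.of_forall fun s => ?_)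
    · have hI : (2 : ℂ) / (Complex.I * f (-t) z) = -Complex.I * (2 / f (-t) z) := by
        rw [← div_div, div_eq_mul_inv 2 Complex.I, Complex.inv_I]; ring
      have hI' : (2 : ℂ) / (Complex.I * f (-t) w) = -Complex.I * (2 / f (-t) w) := by
        rw [← div_div, div_eq_mul_inv 2 Complex.I, Complex.inv_I]; ring
      rw [hI, hI']
      simp only [neg_smul, one_smul]
      ring
    · simp only [Function.comp]; ring
  sq_sub_le := fun z hz a b M hab hM => by
    have h1 := norm_sq_sub_le_of_flow (M := M) (neg_le_neg hab) (hac (-b) (-a))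
      (h.continuous_chain hlam hz) (h.chain_ne_zero hz) (h.hasDerivAt_chain hlam hz)
      (fun t ht => by
        have := hM (-t) ⟨by linarith [ht.2], by linarith [ht.1]⟩
        simpa using this)
    rw [intervalIntegral.integral_comp_neg (fun t => |deriv lam t|)]
    refine le_trans (le_of_eq ?_) h1
    congr 1
    rw [mul_pow, mul_pow, Complex.I_sq]
    push_cast
    ring
  intervalIntegrable := fun a b => by
    have := ((hac (-a) (-b)).intervalIntegrable_deriv.abs).comp_sub_left 0
    simpa using this
  integrable_sq := by simpa only [sq_abs] using hE.comp_neg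

/-- Asymptotics of a chain with finite energy. -/
theorem asymptotics (h : IsSlitChain c F f lam) (hW : IsOpen {u : ℂ | ∀ r, c r ≠ u})
    (hac : ∀ a b, AbsolutelyContinuousOnInterval lam a b)
    (hE : Integrable fun t => (deriv lam t) ^ 2) :
    (TendstoLocallyUniformlyOn (fun (t : ℝ) (z : ℂ) => f t z ^ 2 / (4 * (t : ℂ))) (fun _ => 1)
        atTop (liveDomain c F) ∧
      TendstoLocallyUniformlyOn (fun (t : ℝ) (z : ℂ) => f t z ^ 2 / (4 * (t : ℂ))) (fun _ => 1)
        atBot (liveDomain c F)) ∧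
    ∃ e : ℝ → ℂ → ℝ,
      TendstoLocallyUniformlyOn e (fun _ => 0) atTop (liveDomain c F) ∧
      TendstoLocallyUniformlyOn e (fun _ => 0) atBot (liveDomain c F) ∧
      ∀ t : ℝ, 1 < |t| → ∀ z ∈ liveDomain c F,
        DifferentiableAt ℂ (f t) z ∧ ‖deriv (f t) z‖ = |t| ^ (-(1 / 2 : ℝ) + e t z) := by
  have hlam : Continuous lam := by
    rw [continuous_iff_continuousAt]
    intro t
    refine (hac (t - 1) (t + 1)).continuousOn.continuousAt ?_
    rw [uIcc_of_le (by linarith)]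
    exact Icc_mem_nhds (by linarith) (by linarith)
  have hf := h.isLoewnerFlow hW hlam hac hE
  have hb := h.isLoewnerFlow_reverse hW hlam hac hE
  have hnear : ∀ z ∈ liveDomain c F,
      {w | w ∈ liveDomain c F ∧ ‖w‖ ≤ ‖z‖ + 1} ∈ 𝓝[liveDomain c F] z := by
    intro z hz
    refine inter_mem self_mem_nhdsWithin (mem_nhdsWithin_of_mem_nhds ?_)
    have : ∀ᶠ w : ℂ in 𝓝 z, ‖w‖ < ‖z‖ + 1 :=
      ContinuousAt.eventually_lt continuous_norm.continuousAt continuousAt_const (by simp)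
    exact this.mono fun w hw => hw.le
  refine ⟨⟨?_, ?_⟩, fun t z => Real.log ‖deriv (f t) z‖ / Real.log |t| + 1 / 2, ?_, ?_, ?_⟩
  · rw [Metric.tendstoLocallyUniformlyOn_iff]
    intro ε hε z hz
    obtain ⟨T, hT1, hT⟩ := hf.sq_div_tendsto (‖z‖ + 1) (half_pos hε)
    refine ⟨_, hnear z hz, ?_⟩
    filter_upwards [eventually_ge_atTop T] with t ht w hw
    rw [dist_comm, dist_eq_norm]
    exact (hT t ht w hw.1 hw.2).trans_lt (half_lt_self hε)
  · rw [Metric.tendstoLocallyUniformlyOn_iff]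
    intro ε hε z hz
    obtain ⟨T, hT1, hT⟩ := hb.sq_div_tendsto (‖z‖ + 1) (half_pos hε)
    refine ⟨_, hnear z hz, ?_⟩
    filter_upwards [eventually_le_atBot (-T)] with t ht w hw
    rw [dist_comm, dist_eq_norm]
    refine lt_of_le_of_lt (le_of_eq ?_)
      ((hT (-t) (by linarith) w hw.1 hw.2).trans_lt (half_lt_self hε))
    rw [neg_neg, mul_pow, Complex.I_sq]
    congr 2
    push_cast
    rw [mul_neg, neg_one_mul, neg_div_neg_eq]
  · rw [Metric.tendstoLocallyUniformlyOn_iff]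
    intro ε hε z hz
    obtain ⟨r, hr, hrD, T, hT⟩ := hf.log_deriv_div_log_tendsto hz (half_pos hε)
    refine ⟨_, mem_nhdsWithin_of_mem_nhds (Metric.ball_mem_nhds z hr), ?_⟩
    filter_upwards [eventually_ge_atTop T, eventually_ge_atTop 0] with t ht ht0 w hw
    rw [dist_comm, dist_zero_right, abs_of_nonneg ht0]
    exact (hT t ht w hw).trans_lt (half_lt_self hε)
  · rw [Metric.tendstoLocallyUniformlyOn_iff]
    intro ε hε z hz
    obtain ⟨r, hr, hrD, T, hT⟩ := hb.log_deriv_div_log_tendsto hz (half_pos hε)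
    refine ⟨_, mem_nhdsWithin_of_mem_nhds (Metric.ball_mem_nhds z hr), ?_⟩
    filter_upwards [eventually_le_atBot (-T), eventually_le_atBot 0] with t ht ht0 w hw
    have h1 := hT (-t) (by linarith) w hw
    rw [deriv_const_mul_field, neg_neg, norm_mul, Complex.norm_I, one_mul] at h1
    rw [dist_comm, dist_zero_right, abs_of_nonpos ht0]
    exact h1.trans_lt (half_lt_self hε)
  · intro t ht z hz
    refine ⟨(hf.differentiableOn t).differentiableAt (hf.isOpen.mem_nhds hz), ?_⟩
    have hpos : 0 < ‖deriv (f t) z‖ := norm_pos_iff.2 (hf.deriv_ne_zero t z hz)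
    have hlog : Real.log |t| ≠ 0 := (Real.log_pos ht).ne'
    rw [Real.rpow_def_of_pos (by linarith)]
    have e : Real.log |t| * (-(1 / 2 : ℝ) + (Real.log ‖deriv (f t) z‖ / Real.log |t| + 1 / 2))
        = Real.log ‖deriv (f t) z‖ := by field_simp; ring
    rw [e, Real.exp_log hpos]

end IsSlitChain

/-- Finite Loewner energy means absolutely continuous with square-integrable derivative. -/
theorem of_loewnerEnergy_lt_top {lam : ℝ → ℝ} (h : loewnerEnergy lam < ⊤) :
    (∀ a b, AbsolutelyContinuousOnInterval lam a b) ∧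
      Integrable fun t => (deriv lam t) ^ 2 := by
  unfold loewnerEnergy at h
  split_ifs at h with hac
  · refine ⟨hac, ((measurable_deriv lam).pow_const 2).aestronglyMeasurable, ?_⟩
    rw [hasFiniteIntegral_iff_ofReal (Eventually.of_forall fun t => sq_nonneg _)]
    by_contra hn
    rw [not_lt_top_iff.1 hn, ENNReal.mul_top (by simp)] at h
    exact lt_irrefl _ h
  · exact absurd h (lt_irrefl _)

/-! ### Charts of the sphere -/

theorem invChart_zero : invChart 0 = OnePoint.infty := if_pos rfl

theorem invChart_of_ne {w : ℂ} (hw : w ≠ 0) : invChart w = ((w⁻¹ : ℂ) : OnePoint ℂ) := if_neg hw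

theorem continuous_invChart : Continuous invChart := by
  rw [continuous_iff_continuousAt]
  intro w
  rcases eq_or_ne w 0 with rfl | hw
  · rw [ContinuousAt, invChart_zero, ← nhdsNE_sup_pure, tendsto_sup]
    refine ⟨?_, ?_⟩
    · have h1 : Tendsto (fun w : ℂ => ((w⁻¹ : ℂ) : OnePoint ℂ)) (𝓝[≠] 0) (𝓝 OnePoint.infty) := by
        refine OnePoint.tendsto_coe_infty.comp ?_
        rw [coclosedCompact_eq_cocompact, ← Metric.cobounded_eq_cocompact]
        exact tendsto_inv₀_nhdsNE_zero
      refine h1.congr' ?_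
      filter_upwards [self_mem_nhdsWithin] with w hw using (invChart_of_ne hw).symm
    · rw [tendsto_pure_left]
      intro s hs
      rw [invChart_zero]
      exact mem_of_mem_nhds hs
  · have h1 : ContinuousAt (fun w : ℂ => ((w⁻¹ : ℂ) : OnePoint ℂ)) w :=
      OnePoint.continuous_coe.continuousAt.comp (continuousAt_inv₀ hw)
    refine h1.congr ?_
    filter_upwards [isOpen_ne.mem_nhds hw] with v hv using (invChart_of_ne hv).symm

/-- The inversion `z ↦ 1 / z` of the Riemann sphere. -/
noncomputable def sphereInv (x : Sphere) : Sphere := OnePoint.elim x ((0 : ℂ) : OnePoint ℂ) invChart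

theorem sphereInv_coe (w : ℂ) : sphereInv (w : OnePoint ℂ) = invChart w := rfl

theorem sphereInv_infty : sphereInv OnePoint.infty = ((0 : ℂ) : OnePoint ℂ) := rfl

theorem sphereInv_sphereInv (x : Sphere) : sphereInv (sphereInv x) = x := by
  induction x using OnePoint.rec with
  | infty => rw [sphereInv_infty, sphereInv_coe, invChart_zero]
  | coe w =>
    rw [sphereInv_coe]
    rcases eq_or_ne w 0 with rfl | hw
    · rw [invChart_zero, sphereInv_infty]
    · rw [invChart_of_ne hw, sphereInv_coe, invChart_of_ne (inv_ne_zero hw), inv_inv]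

theorem continuous_sphereInv : Continuous sphereInv := by
  rw [OnePoint.continuous_iff]
  refine ⟨?_, continuous_invChart⟩
  rw [sphereInv_infty, coclosedCompact_eq_cocompact, ← Metric.cobounded_eq_cocompact]
  have h1 : Tendsto (fun w : ℂ => ((w⁻¹ : ℂ) : OnePoint ℂ)) (Bornology.cobounded ℂ)
      (𝓝 ((0 : ℂ) : OnePoint ℂ)) :=
    OnePoint.continuous_coe.continuousAt.tendsto.comp tendsto_inv₀_cobounded
  refine h1.congr' ?_
  filter_upwards [Bornology.eventually_ne_cobounded (0 : ℂ)] with w hw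
  rw [sphereInv_coe, invChart_of_ne hw]

/-- The inversion as a homeomorphism. -/
noncomputable def sphereInvHomeomorph : Sphere ≃ₜ Sphere where
  toFun := sphereInv
  invFun := sphereInv
  left_inv := sphereInv_sphereInv
  right_inv := sphereInv_sphereInv
  continuous_toFun := continuous_sphereInv
  continuous_invFun := continuous_sphereInv

/-- The complement of any point of the sphere is holomorphically a plane. -/
theorem exists_affine_chart (p : Sphere) : ∃ m : Sphere ≃ₜ Sphere, m OnePoint.infty = p ∧
    ∀ (F : Sphere → ℂ) (U : Set Sphere), IsOpen U → HolomorphicOnSphere F U → p ∉ U →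
      DifferentiableOn ℂ (fun u : ℂ => F (m (u : OnePoint ℂ))) {u : ℂ | m (u : OnePoint ℂ) ∈ U} := by
  induction p using OnePoint.rec with
  | infty => exact ⟨Homeomorph.refl _, rfl, fun F U _ hF _ => hF.1⟩
  | coe a =>
    set m := sphereInvHomeomorph.trans (Homeomorph.onePointCongr (Homeomorph.addLeft a)) with hm
    have hm0 : m ((0 : ℂ) : OnePoint ℂ) = OnePoint.infty := by
      show OnePoint.map _ (sphereInv ((0 : ℂ) : OnePoint ℂ)) = _
      rw [sphereInv_coe, invChart_zero]
      rfl
    have hmu : ∀ u : ℂ, u ≠ 0 → m (u : OnePoint ℂ) = ((a + u⁻¹ : ℂ) : OnePoint ℂ) := by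
      intro u hu
      show OnePoint.map _ (sphereInv (u : OnePoint ℂ)) = _
      rw [sphereInv_coe, invChart_of_ne hu]
      rfl
    refine ⟨m, ?_, fun F U hU hF haU u hu => ?_⟩
    · show OnePoint.map _ (sphereInv OnePoint.infty) = _
      rw [sphereInv_infty]
      show ((a + 0 : ℂ) : OnePoint ℂ) = _
      rw [add_zero]
    · refine DifferentiableAt.differentiableWithinAt ?_
      rcases eq_or_ne u 0 with rfl | hu0
      · have hi : OnePoint.infty ∈ U := by rw [← hm0]; exact hu
        have h1 := hF.2 hi
        -- Near u = 0 the point a + 1/u has coordinate 1/(a + 1/u) = u/(1 + au) in the chart at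
        -- infinity, which is holomorphic across 0.
        have hd : DifferentiableAt ℂ (fun u : ℂ => u / (1 + a * u)) 0 :=
          DifferentiableAt.div (by fun_prop) (by fun_prop) (by simp)
        have h0 : (0 : ℂ) / (1 + a * 0) = 0 := by simp
        have h2 : DifferentiableAt ℂ ((fun w : ℂ => F (invChart w)) ∘
            fun u : ℂ => u / (1 + a * u)) 0 := by
          refine DifferentiableAt.comp 0 ?_ hd
          rw [h0]; exact h1
        refine h2.congr_of_eventuallyEq ?_
        have hne : ∀ᶠ u : ℂ in 𝓝 0, 1 + a * u ≠ 0 :=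
          ContinuousAt.eventually_ne (by fun_prop) (by simp)
        filter_upwards [hne] with u hu
        simp only [Function.comp]
        congr 1
        rcases eq_or_ne u 0 with rfl | hu0
        · rw [hm0, zero_div, invChart_zero]
        · rw [hmu u hu0, invChart_of_ne (div_ne_zero hu0 hu)]
          congr 1
          field_simp
          ring
      · have hopen : IsOpen {z : ℂ | (z : OnePoint ℂ) ∈ U} :=
          hU.preimage OnePoint.continuous_coe
        have hmem : (a + u⁻¹ : ℂ) ∈ {z : ℂ | (z : OnePoint ℂ) ∈ U} := by
          show ((a + u⁻¹ : ℂ) : OnePoint ℂ) ∈ U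
          rw [← hmu u hu0]; exact hu
        have h1 := hF.1.differentiableAt (hopen.mem_nhds hmem)
        have h2 : DifferentiableAt ℂ ((fun z : ℂ => F (z : OnePoint ℂ)) ∘ fun u : ℂ => a + u⁻¹) u :=
          DifferentiableAt.comp u h1 ((differentiableAt_inv hu0).const_add a)
        refine h2.congr_of_eventuallyEq ?_
        filter_upwards [isOpen_ne.mem_nhds hu0] with v hv
        simp only [Function.comp]
        rw [hmu v hv]

/-! ### The square root -/

theorem neg_mem_slitPlane {z : ℂ} (hz : z ∈ slitPlus) : -z ∈ Complex.slitPlane := by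
  rw [Complex.mem_slitPlane_iff]
  by_contra! h
  simp only [Complex.neg_re, Complex.neg_im, neg_eq_zero] at h
  exact hz ⟨h.2, by linarith [h.1]⟩

theorem sqrtUp_of_mem {z : ℂ} (hz : z ∈ slitPlus) :
    sqrtUp z = Complex.I * (-z) ^ (1 / 2 : ℂ) := if_pos hz

theorem sqrtUp_sq (z : ℂ) : sqrtUp z ^ 2 = z := by
  by_cases hz : z ∈ slitPlus
  · rw [sqrtUp_of_mem hz, mul_pow, Complex.I_sq, ← Complex.cpow_nat_mul]
    norm_num
  · rw [sqrtUp, if_neg hz]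
    simp only [slitPlus, mem_ofPred_eq, not_not] at hz
    rw [← Complex.ofReal_pow, Real.sq_sqrt hz.2]
    apply Complex.ext <;> simp [hz.1]

theorem sqrtUp_mem {z : ℂ} (hz : z ∈ slitPlus) : sqrtUp z ∈ upperHalf := by
  show 0 < (sqrtUp z).im
  have hs := neg_mem_slitPlane hz
  rw [sqrtUp_of_mem hz, Complex.I_mul_im, Complex.cpow_def_of_ne_zero (Complex.slitPlane_ne_zero hs),
    Complex.exp_re]
  refine mul_pos (Real.exp_pos _) (Real.cos_pos_of_mem_Ioo ?_)
  have him : (Complex.log (-z) * (1 / 2)).im = (-z).arg / 2 := by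
    have : (1 / 2 : ℂ) = ((1 / 2 : ℝ) : ℂ) := by push_cast; rfl
    rw [this, Complex.im_mul_ofReal, Complex.log_im]
    ring
  rw [him]
  have h1 := Complex.neg_pi_lt_arg (-z)
  have h2 := Complex.arg_le_pi (-z)
  have h3 := Complex.mem_slitPlane_iff_arg.1 hs
  have h4 : (-z).arg < Real.pi := lt_of_le_of_ne h2 h3.1
  constructor <;> linarith

theorem sq_mem_slitPlus {z : ℂ} (hz : z ∈ upperHalf) : z ^ 2 ∈ slitPlus := by
  have hz' : 0 < z.im := hz
  rintro ⟨h1, h2⟩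
  rw [pow_two, Complex.mul_im] at h1
  rw [pow_two, Complex.mul_re] at h2
  have h3 : z.re = 0 := by
    have : 2 * (z.im * z.re) = 0 := by linarith
    simpa [hz'.ne'] using this
  rw [h3] at h2
  nlinarith

theorem eq_of_sq_eq_sq {z w : ℂ} (hz : z ∈ upperHalf) (hw : w ∈ upperHalf) (h : z ^ 2 = w ^ 2) :
    z = w := by
  have hz' : 0 < z.im := hz
  have hw' : 0 < w.im := hw
  rcases sq_eq_sq_iff_eq_or_eq_neg.1 h with h | h
  · exact h
  · rw [h, Complex.neg_im] at hz'
    linarith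

theorem bijOn_sqrtUp : BijOn sqrtUp slitPlus upperHalf := by
  refine ⟨fun z hz => sqrtUp_mem hz, fun z _ w _ h => ?_, fun z hz => ?_⟩
  · rw [← sqrtUp_sq z, h, sqrtUp_sq]
  · exact ⟨z ^ 2, sq_mem_slitPlus hz, eq_of_sq_eq_sq (sqrtUp_mem (sq_mem_slitPlus hz)) hz
      (sqrtUp_sq _)⟩

theorem differentiableOn_sqrtUp : DifferentiableOn ℂ sqrtUp slitPlus := by
  have h1 : DifferentiableOn ℂ (fun z : ℂ => Complex.I * (-z) ^ (1 / 2 : ℂ)) slitPlus := by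
    intro z hz
    exact ((differentiableAt_id.neg.cpow_const (neg_mem_slitPlane hz)).const_mul
      _).differentiableWithinAt
  exact h1.congr fun z hz => sqrtUp_of_mem hz

/-- The branch jumps across the slit, but its modulus √|z| does not. -/
theorem tendsto_sqrtUp_zero : Tendsto sqrtUp (𝓝 0) (𝓝 0) := by
  rw [tendsto_zero_iff_norm_tendsto_zero]
  have h1 : ∀ z, ‖sqrtUp z‖ = Real.sqrt ‖z‖ := by
    intro z
    rw [← Real.sqrt_sq (norm_nonneg (sqrtUp z)), ← norm_pow, sqrtUp_sq]
  simp_rw [h1]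
  have h2 : Continuous fun z : ℂ => Real.sqrt ‖z‖ := by fun_prop
  simpa using h2.tendsto 0

/-! ### Reduction to the plane -/

theorem isOpen_slitDomain {γ : EReal → Sphere} (hγ : Continuous γ) (t : ℝ) :
    IsOpen (slitDomain γ t) :=
  ((isClosed_Iic.isCompact).image hγ).isClosed.isOpen_compl

/-- A loop in the sphere with its uniformizing maps becomes a chain in the plane when its root is
sent to infinity. -/
theorem exists_isSlitChain {γ : EReal → Sphere} (hγ : IsJordanCurve γ) {H : ℝ → Sphere → ℂ}
    (hH : IsUniformizingFamily γ H) {lam : ℝ → ℝ} (hlam : IsDrivingFunction γ H lam) :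
    ∃ (c : ℝ → ℂ) (F : ℝ → ℂ → ℂ), IsSlitChain c F (fChain γ H) lam ∧
      IsOpen {u : ℂ | ∀ r, c r ≠ u} ∧ commonDomain γ H = liveDomain c F := by
  obtain ⟨m, hm, hhol⟩ := exists_affine_chart (γ ⊤)
  have hmne : ∀ u : ℂ, m (u : OnePoint ℂ) ≠ γ ⊤ := by
    intro u h
    rw [← hm] at h
    exact OnePoint.coe_ne_infty u (m.injective h)
  have hroot : ∀ r : ℝ, γ r ≠ γ ⊤ := by
    intro r h
    rw [← hγ.closed] at h
    exact EReal.coe_ne_bot r (hγ.injOn (mem_Iio.2 (EReal.coe_lt_top r)) (mem_Iio.2 bot_lt_top) h)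
  have hex : ∀ x : Sphere, x ≠ γ ⊤ → ∃ u : ℂ, m (u : OnePoint ℂ) = x := by
    intro x hx
    have : m.symm x ≠ OnePoint.infty := by
      intro h
      apply hx
      rw [← hm, ← h, m.apply_symm_apply]
    obtain ⟨u, hu⟩ := OnePoint.ne_infty_iff_exists.1 this
    exact ⟨u, by rw [hu, m.apply_symm_apply]⟩
  choose c hc using fun r : ℝ => hex (γ r) (hroot r)
  have hminj : ∀ u v : ℂ, m (u : OnePoint ℂ) = m (v : OnePoint ℂ) → u = v := fun u v h =>
    OnePoint.coe_injective (m.injective h)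
  have hcoe : Continuous fun u : ℂ => m (u : OnePoint ℂ) := m.continuous.comp OnePoint.continuous_coe
  have hV : ∀ (t : ℝ) (u : ℂ), u ∈ slitCompl c t ↔ m (u : OnePoint ℂ) ∈ slitDomain γ t := by
    intro t u
    constructor
    · rintro hu ⟨x, hx, hxu⟩
      induction x with
      | bot => exact hmne u (by rw [← hxu, hγ.closed])
      | top => exact absurd hx (not_le.2 (EReal.coe_lt_top t))
      | coe r =>
        refine hu r (EReal.coe_le_coe_iff.1 hx) (hminj _ _ ?_)
        rw [hc, hxu]
    · intro hu r hr hru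
      exact hu ⟨r, EReal.coe_le_coe_iff.2 hr, by rw [← hc, hru]⟩
  have hVset : ∀ t, slitCompl c t = {u : ℂ | m (u : OnePoint ℂ) ∈ slitDomain γ t} := fun t =>
    Set.ext (hV t)
  have hrootmem : ∀ t : ℝ, γ ⊤ ∉ slitDomain γ t := fun t h => h ⟨⊥, mem_Iic.2 bot_le, hγ.closed⟩
  have hWset : ∀ u : ℂ, (∀ r, c r ≠ u) ↔ m (u : OnePoint ℂ) ∈ (range γ)ᶜ := by
    intro u
    constructor
    · rintro hu ⟨x, hxu⟩
      induction x with
      | bot => exact hmne u (by rw [← hxu, hγ.closed])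
      | top => exact hmne u hxu.symm
      | coe r => exact hu r (hminj _ _ (by rw [hc, hxu]))
    · intro hu r hru
      exact hu ⟨r, by rw [← hc, hru]⟩
  set F : ℝ → ℂ → ℂ := fun t u => sqrtUp (H t (m (u : OnePoint ℂ))) with hF
  have hchain : IsSlitChain c F (fChain γ H) lam := by
    refine ⟨?_, ?_, ?_, ?_, ?_, ?_, ?_, hlam⟩
    · rw [OnePoint.isOpenEmbedding_coe.isInducing.continuous_iff]
      have : (OnePoint.some ∘ c) = fun r : ℝ => m.symm (γ r) := by
        funext r
        rw [← hc r, m.symm_apply_apply]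
        rfl
      rw [this]
      exact m.symm.continuous.comp (hγ.continuous.comp continuous_coe_real_ereal)
    · intro r s hrs
      have h1 : γ r = γ s := by rw [← hc, ← hc, hrs]
      exact EReal.coe_injective (hγ.injOn (EReal.coe_lt_top r) (EReal.coe_lt_top s) h1)
    · intro t
      rw [hVset]
      exact (isOpen_slitDomain hγ.continuous t).preimage hcoe
    · intro t
      rw [hVset]
      refine differentiableOn_sqrtUp.comp (hhol (H t) _ (isOpen_slitDomain hγ.continuous t)
        (hH.holomorphic t) (hrootmem t)) fun u hu => (hH.bijOn t).mapsTo hu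
    · intro t
      refine bijOn_sqrtUp.comp ((hH.bijOn t).comp ⟨fun u hu => (hV t u).1 hu,
        fun u _ v _ h => hminj u v h, fun x hx => ?_⟩)
      obtain ⟨u, hu⟩ := hex x fun h => hrootmem t (h ▸ hx)
      exact ⟨u, (hV t u).2 (hu ▸ hx), hu⟩
    · intro t
      refine tendsto_sqrtUp_zero.comp ((hH.tip t).comp (tendsto_nhdsWithin_iff.2 ⟨?_, ?_⟩))
      · rw [← hc t]
        exact hcoe.continuousAt.tendsto.mono_left nhdsWithin_le_nhds
      · filter_upwards [self_mem_nhdsWithin] with u hu using (hV t u).1 hu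
    · intro t u hu
      -- Squaring undoes the root in F_0, so H_0⁻¹ recovers the point of the sphere represented by
      -- u.
      simp only [fChain, hChain, hF, sqrtUp_sq]
      rw [(hH.bijOn 0).injOn.leftInvOn_invFunOn ((hV 0 u).1 hu)]
  refine ⟨c, F, hchain, ?_, ?_⟩
  · have : {u : ℂ | ∀ r, c r ≠ u} = {u : ℂ | m (u : OnePoint ℂ) ∈ (range γ)ᶜ} := Set.ext hWset
    rw [this]
    exact (isCompact_range hγ.continuous).isClosed.isOpen_compl.preimage hcoe
  · ext z
    refine and_congr_right fun hz => ?_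
    have h0 := hchain.slitInv_mem 0 hz
    have hFz : sqrtUp (H 0 (m (slitInv c F 0 z : OnePoint ℂ))) = z := hchain.apply_slitInv 0 hz
    have hHz : H 0 (m (slitInv c F 0 z : OnePoint ℂ)) = z ^ 2 := by rw [← sqrtUp_sq (H 0 _), hFz]
    have hiff : (∀ t, slitInv c F 0 z ∈ slitCompl c t) ↔
        m (slitInv c F 0 z : OnePoint ℂ) ∈ (range γ)ᶜ := by
      rw [← hWset]
      exact ⟨fun h r => h r r le_rfl, fun h t r _ => h r⟩
    rw [hiff]
    constructor
    · rintro ⟨x, hx, hxz⟩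
      have hx0 : x ∈ slitDomain γ 0 := fun h => hx (image_subset_range _ _ h)
      have : x = m (slitInv c F 0 z : OnePoint ℂ) :=
        (hH.bijOn 0).injOn hx0 ((hV 0 _).1 h0) (hxz.trans hHz.symm)
      rwa [← this]
    · intro h
      exact ⟨_, h, hHz⟩

end LoopLoewner

theorem mainTheorem7 (γ : EReal → LoopLoewner.Sphere) (hγ : LoopLoewner.IsJordanCurve γ)
    (H : ℝ → LoopLoewner.Sphere → ℂ) (hH : LoopLoewner.IsUniformizingFamily γ H)
    (lam : ℝ → ℝ) (hlam : LoopLoewner.IsDrivingFunction γ H lam)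
    (henergy : LoopLoewner.loewnerEnergy lam < ⊤) :
    (TendstoLocallyUniformlyOn
        (fun (t : ℝ) (z : ℂ) => LoopLoewner.fChain γ H t z ^ 2 / (4 * (t : ℂ))) (fun _ => 1)
        atTop (LoopLoewner.commonDomain γ H) ∧
      TendstoLocallyUniformlyOn
        (fun (t : ℝ) (z : ℂ) => LoopLoewner.fChain γ H t z ^ 2 / (4 * (t : ℂ))) (fun _ => 1)
        atBot (LoopLoewner.commonDomain γ H)) ∧
    ∃ e : ℝ → ℂ → ℝ,
      TendstoLocallyUniformlyOn e (fun _ => 0) atTop (LoopLoewner.commonDomain γ H) ∧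
      TendstoLocallyUniformlyOn e (fun _ => 0) atBot (LoopLoewner.commonDomain γ H) ∧
      ∀ t : ℝ, 1 < |t| → ∀ z ∈ LoopLoewner.commonDomain γ H,
        DifferentiableAt ℂ (LoopLoewner.fChain γ H t) z ∧
        ‖deriv (LoopLoewner.fChain γ H t) z‖ = |t| ^ (-(1 / 2 : ℝ) + e t z) := by
  obtain ⟨c, F, hchain, hW, hD⟩ := LoopLoewner.exists_isSlitChain hγ hH hlam
  obtain ⟨hac, hE⟩ := LoopLoewner.of_loewnerEnergy_lt_top henergy
  rw [hD]
  exact hchain.asymptotics hW hac hE
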